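/- Let $\varphi_0=e^{123}+e^{145}+e^{167}+e^{246}-e^{257}-e^{347}-e^{356}$ on Euclidean space $\mathbb R^7$, and let $\times$ be the cross product defined by $\langle u\times v,w\rangle=\varphi_0(u,v,w)$. Let $G(3,7)$ be the Grassmannian manifold of oriented $3$-planes in $\mathbb R^7$, with canonical bundle $\mathbb E$ (whose fibre at $L$ is $L$) and complementary bundle $\mathbb V=\mathbb E^\perp$ (whose fibre at $L$ is $L^\perp$). Identify $TG(3,7)$ with $\mathbb E^*\otimes\mathbb V$ by the canonical isomorphism, under which the velocity at $t=0$ of a curve of planes $L(t)$ with $L(0)=L$ is the homomorphism $L\to L^\perp$ that sends $e(0)$ to the component of $\dot e(0)$ orthogonal to $L$, for every differentiable curve of vectors $e(t)\in L(t)$. Let $G^{\varphi_0}(3,7)=\{L\in G(3,7) : \varphi_0|_L=\mathrm{vol}(L)\}$ be the set of associative planes. Then $G^{\varphi_0}(3,7)$ is a smooth embedded submanifold of $G(3,7)$ (of dimension $8$). If $L\in G^{\varphi_0}(3,7)$ and $\{e_1,e_2,e_3\}$ is an orthonormal basis of $L$ with $e_3=e_1\times e_2$ and dual basis $\{e^1,e^2,e^3\}$,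 then $$T_LG^{\varphi_0}(3,7)=\Big\{\sum_{j=1}^3 e^j\otimes v_j\in \mathbb E_L^*\otimes\mathbb V_L \;:\; \sum_{j=1}^3 e_j\times v_j=0\Big\}.$$ Moreover, the normal bundle $TG(3,7)|_{G^{\varphi_0}(3,7)}/TG^{\varphi_0}(3,7)$ is isomorphic, as a smooth vector bundle over $G^{\varphi_0}(3,7)$, to the restriction of $\mathbb V$, by the isomorphism which at $L$ sends the class of $\sum e^j\otimes v_j$ to $\sum e_j\times v_j$ (for any basis of $L$ as above). -/

import Mathlib

open Set Module
open scoped Manifold ContDiff TensorProduct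

noncomputable section

/-! ### The standard `3`-form and the cross product of `ℝ⁷` -/

/-- Euclidean `7`-space. -/
abbrev R7 : Type := EuclideanSpace ℝ (Fin 7)

/-- The `3`-form `eⁱ ∧ eʲ ∧ eᵏ` on `ℝ⁷`; its value on `(u, v, w)` is the `3 × 3` determinant of the
coordinates with indices `i, j, k`. -/
def wedge3 (i j k : Fin 7) : R7 [⋀^Fin 3]→ₗ[ℝ] ℝ :=
  (Matrix.detRowAlternating : (Fin 3 → ℝ) [⋀^Fin 3]→ₗ[ℝ] ℝ).compLinearMap
    ((LinearMap.funLeft ℝ ℝ ![i, j, k]).comp (WithLp.linearEquiv 2 ℝ (Fin 7 → ℝ)).toLinearMap)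

/-- The standard `G₂`-form
`φ₀ = e¹²³ + e¹⁴⁵ + e¹⁶⁷ + e²⁴⁶ - e²⁵⁷ - e³⁴⁷ - e³⁵⁶` (the indices below start at `0`). -/
def phi0 : R7 [⋀^Fin 3]→ₗ[ℝ] ℝ :=
  wedge3 0 1 2 + wedge3 0 3 4 + wedge3 0 5 6 + wedge3 1 3 5
    - wedge3 1 4 6 - wedge3 2 3 6 - wedge3 2 4 5

/-- The cross product of `ℝ⁷`, characterized by `⟨u × v, w⟩ = φ₀(u, v, w)`
(see `inner_cross`): its `k`-th coordinate is `φ₀(u, v, e_k)`. -/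
def cross (u v : R7) : R7 :=
  WithLp.toLp 2 fun k => phi0 ![u, v, EuclideanSpace.single k 1]

theorem inner_cross (u v w : R7) : inner ℝ (cross u v) w = phi0 ![u, v, w] := by
  have hw : w = ∑ k, w k • EuclideanSpace.single k (1 : ℝ) := by
    ext i
    simp [Finset.sum_apply, Pi.single_apply]
  have hlin : ∀ x : R7, phi0 ![u, v, x] =
      (phi0.toMultilinearMap.toLinearMap ![u, v, 0] 2) x := by
    intro x
    simp only [MultilinearMap.toLinearMap_apply, AlternatingMap.coe_multilinearMap]
    congr 1
    ext j
    fin_cases j <;> simp [Function.update]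
  rw [hlin]
  conv_rhs => rw [hw]
  rw [map_sum, PiLp.inner_apply]
  refine Finset.sum_congr rfl fun k _ => ?_
  rw [map_smul, ← hlin]
  simp [cross]

/-! ### Oriented `3`-planes and the smooth manifold `G(3,7)` -/

/-- An oriented `3`-dimensional linear subspace of `ℝ⁷`, that is, a point of `G(3,7)`. -/
structure OrientedPlane where
  /-- the underlying linear subspace -/
  plane : Submodule ℝ R7
  /-- it has dimension three -/
  finrank_eq : finrank ℝ plane = 3
  /-- the orientation of the subspace -/
  orientation : Orientation ℝ plane (Fin 3)

namespace OrientedPlane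

instance (L : OrientedPlane) : Fact (finrank ℝ L.plane = 3) := ⟨L.finrank_eq⟩

/-- The standard orientation of `ℝ³`. -/
def stdOrientation : Orientation ℝ (Fin 3 → ℝ) (Fin 3) := (Pi.basisFun ℝ (Fin 3)).orientation

/-- The image of an injective linear map `ℝ³ → ℝ⁷`, with the orientation carried over from `ℝ³`. -/
def ofInjective (f : (Fin 3 → ℝ) →ₗ[ℝ] R7) (hf : Function.Injective f) : OrientedPlane where
  plane := LinearMap.range f
  finrank_eq := by simp [LinearMap.finrank_range_of_inj hf]
  orientation := Orientation.map (Fin 3) (LinearEquiv.ofInjective f hf) stdOrientation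

theorem eq_ofInjective_iff (L : OrientedPlane) (f : (Fin 3 → ℝ) →ₗ[ℝ] R7)
    (hf : Function.Injective f) :
    L = ofInjective f hf ↔ ∃ k : (Fin 3 → ℝ) ≃ₗ[ℝ] L.plane,
      (∀ x, (k x : R7) = f x) ∧ Orientation.map (Fin 3) k stdOrientation = L.orientation := by
  constructor
  · rintro rfl
    exact ⟨LinearEquiv.ofInjective f hf, fun x => rfl, rfl⟩
  · rintro ⟨k, hk, ho⟩
    obtain ⟨M, hM, o⟩ := L
    simp only at k hk ho
    have hMf : M = LinearMap.range f := by
      ext y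
      constructor
      · intro hy
        exact ⟨k.symm ⟨y, hy⟩, by rw [← hk]; simp⟩
      · rintro ⟨x, rfl⟩
        rw [← hk]
        exact (k x).2
    subst hMf
    have : k = LinearEquiv.ofInjective f hf := by
      ext x
      simp [hk]
    subst this
    unfold ofInjective
    congr 1
    exact ho.symm

theorem exists_eq_ofInjective (L : OrientedPlane) :
    ∃ (f : (Fin 3 → ℝ) →ₗ[ℝ] R7) (hf : Function.Injective f), L = ofInjective f hf := by
  let B := L.orientation.someBasis (by simp [L.finrank_eq])
  have hinj : Function.Injective (L.plane.subtype.comp B.equivFun.symm.toLinearMap) :=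
    L.plane.injective_subtype.comp B.equivFun.symm.injective
  refine ⟨_, hinj, ?_⟩
  rw [eq_ofInjective_iff]
  refine ⟨B.equivFun.symm, fun x => rfl, ?_⟩
  rw [stdOrientation, ← Basis.orientation_map]
  have : (Pi.basisFun ℝ (Fin 3)).map B.equivFun.symm = B := by
    ext i
    simp
  rw [this]
  exact L.orientation.someBasis_orientation _

theorem ofInjective_eq_iff (f g : (Fin 3 → ℝ) →ₗ[ℝ] R7) (hf : Function.Injective f)
    (hg : Function.Injective g) :
    ofInjective f hf = ofInjective g hg ↔
      ∃ h : (Fin 3 → ℝ) ≃ₗ[ℝ] (Fin 3 → ℝ),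
        0 < LinearMap.det (h : (Fin 3 → ℝ) →ₗ[ℝ] (Fin 3 → ℝ)) ∧ ∀ x, f (h x) = g x := by
  have key : ∀ h : (Fin 3 → ℝ) ≃ₗ[ℝ] (Fin 3 → ℝ),
      Orientation.map (Fin 3) h stdOrientation = stdOrientation ↔
        0 < LinearMap.det (h : (Fin 3 → ℝ) →ₗ[ℝ] (Fin 3 → ℝ)) :=
    fun h => Orientation.map_eq_iff_det_pos _ h (by simp)
  have mapc : ∀ h : (Fin 3 → ℝ) ≃ₗ[ℝ] (Fin 3 → ℝ),
      Orientation.map (Fin 3) (h.trans (LinearEquiv.ofInjective f hf)) stdOrientation =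
      Orientation.map (Fin 3) (LinearEquiv.ofInjective f hf)
        (Orientation.map (Fin 3) h stdOrientation) := by
    intro h
    rw [stdOrientation, ← Basis.orientation_map, ← Basis.orientation_map, ← Basis.orientation_map]
    rfl
  rw [eq_ofInjective_iff]
  constructor
  · rintro ⟨k, hk, ho⟩
    refine ⟨k.trans (LinearEquiv.ofInjective f hf).symm, ?_, fun x => ?_⟩
    · rw [← key]
      apply (Orientation.map (Fin 3) (LinearEquiv.ofInjective f hf)).injective
      rw [← mapc]
      have : (k.trans (LinearEquiv.ofInjective f hf).symm).trans
          (LinearEquiv.ofInjective f hf) = k := by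
        refine LinearEquiv.ext fun x => ?_
        exact LinearEquiv.apply_symm_apply (LinearEquiv.ofInjective f hf) (k x)
      rw [this]
      exact ho
    · rw [← hk x]
      have := LinearEquiv.apply_symm_apply (LinearEquiv.ofInjective f hf) (k x)
      exact congrArg Subtype.val this
  · rintro ⟨h, hdet, hh⟩
    refine ⟨h.trans (LinearEquiv.ofInjective f hf), fun x => hh x, ?_⟩
    refine (mapc h).trans ?_
    rw [(key h).2 hdet]
    rfl

/-- The vector space `Hom(ℝ³, ℝ⁴)` on which `G(3,7)` is modelled. -/
abbrev Model : Type := (Fin 3 → ℝ) →L[ℝ] (Fin 4 → ℝ)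

/-- A splitting `ℝ³ × ℝ⁴ ≅ ℝ⁷`. -/
abbrev Splitting : Type := ((Fin 3 → ℝ) × (Fin 4 → ℝ)) ≃L[ℝ] R7

/-- The embedding `ℝ³ → ℝ⁷`, `x ↦ b (x, A x)`, of the graph of `A`. -/
def graphMap (b : Splitting) (A : Model) : (Fin 3 → ℝ) →ₗ[ℝ] R7 :=
  b.toLinearEquiv.toLinearMap.comp (LinearMap.id.prod A.toLinearMap)

@[simp] theorem graphMap_apply (b : Splitting) (A : Model) (x : Fin 3 → ℝ) :
    graphMap b A x = b (x, A x) := rfl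

theorem graphMap_injective (b : Splitting) (A : Model) : Function.Injective (graphMap b A) := by
  intro x y h
  exact congrArg Prod.fst (b.injective h)

/-- The graph of `A`, as an oriented `3`-plane of `ℝ⁷ ≅ ℝ³ × ℝ⁴`. -/
def graph (b : Splitting) (A : Model) : OrientedPlane :=
  ofInjective (graphMap b A) (graphMap_injective b A)

/-- The block `ℝ³ → ℝ³` of a change of splitting, along the graph of `A`. -/
def blockFst (b b' : Splitting) (A : Model) : (Fin 3 → ℝ) →L[ℝ] (Fin 3 → ℝ) :=
  (ContinuousLinearMap.fst ℝ (Fin 3 → ℝ) (Fin 4 → ℝ)).comp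
    ((b.trans b'.symm : _ →L[ℝ] _).comp ((ContinuousLinearMap.id ℝ _).prod A))

/-- The block `ℝ³ → ℝ⁴` of a change of splitting, along the graph of `A`. -/
def blockSnd (b b' : Splitting) (A : Model) : (Fin 3 → ℝ) →L[ℝ] (Fin 4 → ℝ) :=
  (ContinuousLinearMap.snd ℝ (Fin 3 → ℝ) (Fin 4 → ℝ)).comp
    ((b.trans b'.symm : _ →L[ℝ] _).comp ((ContinuousLinearMap.id ℝ _).prod A))

theorem blocks_apply (b b' : Splitting) (A : Model) (x : Fin 3 → ℝ) :
    b' (blockFst b b' A x, blockSnd b b' A x) = b (x, A x) := by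
  have : (blockFst b b' A x, blockSnd b b' A x) = b'.symm (b (x, A x)) := rfl
  rw [this, ContinuousLinearEquiv.apply_symm_apply]

theorem contDiff_id_prod {n : ℕ∞ω} :
    ContDiff ℝ n fun A : Model => (ContinuousLinearMap.id ℝ (Fin 3 → ℝ)).prod A := by
  have : (fun A : Model => (ContinuousLinearMap.id ℝ (Fin 3 → ℝ)).prod A) = fun A =>
      ContinuousLinearMap.inl ℝ (Fin 3 → ℝ) (Fin 4 → ℝ) +
        (ContinuousLinearMap.inr ℝ (Fin 3 → ℝ) (Fin 4 → ℝ)).comp A := by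
    funext A
    refine ContinuousLinearMap.ext fun x => ?_
    simp
  rw [this]
  exact contDiff_const.add (contDiff_const.clm_comp contDiff_id)

theorem contDiff_blockFst (b b' : Splitting) {n : ℕ∞ω} : ContDiff ℝ n (blockFst b b') := by
  exact contDiff_const.clm_comp (contDiff_const.clm_comp contDiff_id_prod)

theorem contDiff_blockSnd (b b' : Splitting) {n : ℕ∞ω} : ContDiff ℝ n (blockSnd b b') := by
  exact contDiff_const.clm_comp (contDiff_const.clm_comp contDiff_id_prod)

theorem graph_eq_graph_iff (b b' : Splitting) (A A' : Model) :
    graph b A = graph b' A' ↔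
      0 < (blockFst b b' A).det ∧ A' = (blockSnd b b' A).comp (blockFst b b' A).inverse := by
  unfold graph
  rw [ofInjective_eq_iff]
  constructor
  · rintro ⟨h, hdet, hh⟩
    have h1 : ∀ x, blockFst b b' A (h x) = x ∧ blockSnd b b' A (h x) = A' x := by
      intro x
      have := hh x
      rw [graphMap_apply, graphMap_apply, ← blocks_apply b b'] at this
      exact Prod.ext_iff.1 (b'.injective this)
    have hP : blockFst b b' A = (h.symm.toContinuousLinearEquiv : _ →L[ℝ] _) := by
      ext1 x
      have := (h1 (h.symm x)).1
      rw [h.apply_symm_apply] at this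
      simpa using this
    refine ⟨?_, ?_⟩
    · rw [hP]
      change 0 < LinearMap.det (h.symm : (Fin 3 → ℝ) →ₗ[ℝ] (Fin 3 → ℝ))
      rw [LinearEquiv.det_coe_symm]
      exact inv_pos.2 hdet
    · rw [hP, ContinuousLinearMap.inverse_equiv]
      ext1 x
      exact ((h1 x).2).symm
  · rintro ⟨hdet, rfl⟩
    let p : (Fin 3 → ℝ) ≃ₗ[ℝ] (Fin 3 → ℝ) :=
      LinearEquiv.ofIsUnitDet
        (v := Pi.basisFun ℝ (Fin 3)) (v' := Pi.basisFun ℝ (Fin 3))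
        (f := (blockFst b b' A).toLinearMap)
        (by
          rw [LinearMap.det_toMatrix]
          exact (ne_of_gt hdet).isUnit)
    have hp : ∀ x, p x = blockFst b b' A x := fun x => rfl
    have hP : blockFst b b' A = (p.toContinuousLinearEquiv : _ →L[ℝ] _) := by
      ext1 x
      exact (hp x).symm
    refine ⟨p.symm, ?_, fun x => ?_⟩
    · rw [LinearEquiv.det_coe_symm]
      exact inv_pos.2 hdet
    · have hx : (blockFst b b' A).inverse x = p.symm x := by
        rw [hP, ContinuousLinearMap.inverse_equiv]
        rfl
      rw [graphMap_apply, graphMap_apply, ← blocks_apply b b', ← hp, p.apply_symm_apply]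
      rw [ContinuousLinearMap.comp_apply, hx]

theorem graph_injective (b : Splitting) : Function.Injective (graph b) := by
  intro A A' h
  have h1 := ((graph_eq_graph_iff b b A A').1 h).2
  have h2 := ((graph_eq_graph_iff b b A A).1 rfl).2
  rw [h1, ← h2]

/-- The chart of `G(3,7)` given by a splitting `b : ℝ³ × ℝ⁴ ≅ ℝ⁷`: it sends the graph of
`A : ℝ³ → ℝ⁴`, oriented by `ℝ³`, to `A`. -/
def graphChart (b : Splitting) : PartialEquiv OrientedPlane Model where
  toFun := Function.invFun (graph b)
  invFun := graph b
  source := range (graph b)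
  target := univ
  map_source' _ _ := mem_univ _
  map_target' A _ := mem_range_self A
  left_inv' _ hL := Function.invFun_eq hL
  right_inv' A _ := Function.leftInverse_invFun (graph_injective b) A

theorem exists_mem_graphChart_source (L : OrientedPlane) :
    ∃ b : Splitting, L ∈ (graphChart b).source := by
  obtain ⟨f, hf, rfl⟩ := exists_eq_ofInjective L
  obtain ⟨W, hW⟩ := Submodule.exists_isCompl (LinearMap.range f)
  have hfr : finrank ℝ (LinearMap.range f) = 3 := by
    simp [LinearMap.finrank_range_of_inj hf]
  have hWr : finrank ℝ W = 4 := by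
    have := Submodule.finrank_add_eq_of_isCompl hW
    rw [hfr] at this
    simp at this
    omega
  let w : (Fin 4 → ℝ) ≃ₗ[ℝ] W := LinearEquiv.ofFinrankEq _ _ (by simp [hWr])
  let c : ((Fin 3 → ℝ) × (Fin 4 → ℝ)) ≃ₗ[ℝ] R7 :=
    ((LinearEquiv.ofInjective f hf).prodCongr w).trans
      (Submodule.prodEquivOfIsCompl _ _ hW)
  refine ⟨c.toContinuousLinearEquiv, 0, ?_⟩
  unfold graph
  congr 1
  refine LinearMap.ext fun x => ?_
  simp [c]

theorem graphChart_trans_source (b b' : Splitting) :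
    ((graphChart b).symm.trans (graphChart b')).source = {A | 0 < (blockFst b b' A).det} := by
  ext A
  simp only [PartialEquiv.trans_source, mem_inter_iff, mem_preimage, mem_ofPred_eq]
  constructor
  · rintro ⟨-, A', hA'⟩
    exact ((graph_eq_graph_iff b b' A A').1 hA'.symm).1
  · intro h
    exact ⟨mem_univ _, _, ((graph_eq_graph_iff b b' A _).2 ⟨h, rfl⟩).symm⟩

theorem graphChart_trans_apply (b b' : Splitting) {A : Model}
    (hA : A ∈ ((graphChart b).symm.trans (graphChart b')).source) :
    (graphChart b).symm.trans (graphChart b') A =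
      (blockSnd b b' A).comp (blockFst b b' A).inverse := by
  rw [graphChart_trans_source] at hA
  have h : graph b A = graph b' ((blockSnd b b' A).comp (blockFst b b' A).inverse) :=
    (graph_eq_graph_iff b b' A _).2 ⟨hA, rfl⟩
  change Function.invFun (graph b') (graph b A) = _
  rw [h, Function.leftInverse_invFun (graph_injective b')]

theorem contDiffOn_graphChart_trans (b b' : Splitting) {n : ℕ∞ω} :
    ContDiffOn ℝ n ((graphChart b).symm.trans (graphChart b'))
      ((graphChart b).symm.trans (graphChart b')).source := by
  refine ContDiffOn.congr ?_ fun A hA => graphChart_trans_apply b b' hA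
  rw [graphChart_trans_source]
  intro A hA
  apply ContDiffAt.contDiffWithinAt
  have hdet : IsUnit (blockFst b b' A).det := (ne_of_gt hA).isUnit
  have hP : blockFst b b' A =
      ((blockFst b b' A).toContinuousLinearEquivOfDetNeZero (ne_of_gt hA) : _ →L[ℝ] _) := by
    simp
  have hinv : ContDiffAt ℝ n ContinuousLinearMap.inverse (blockFst b b' A) := by
    rw [hP]
    exact contDiffAt_map_inverse _
  exact (contDiff_blockSnd b b').contDiffAt.clm_comp
    (ContDiffAt.comp A hinv (contDiff_blockFst b b').contDiffAt)

theorem isOpen_graphChart_trans_source (b b' : Splitting) :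
    IsOpen ((graphChart b).symm.trans (graphChart b')).source := by
  rw [graphChart_trans_source]
  exact isOpen_lt continuous_const (ContinuousLinearMap.continuous_det.comp
    (contDiff_blockFst b b' (n := 0)).continuous)

/-- The atlas of `G(3,7)` formed by all graph charts. -/
def core : ChartedSpaceCore Model OrientedPlane where
  atlas := range graphChart
  chartAt L := graphChart (exists_mem_graphChart_source L).choose
  mem_chart_source L := (exists_mem_graphChart_source L).choose_spec
  chart_mem_atlas _ := mem_range_self _
  open_source := by
    rintro _ _ ⟨b, rfl⟩ ⟨b', rfl⟩
    exact isOpen_graphChart_trans_source b b'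
  continuousOn_toFun := by
    rintro _ _ ⟨b, rfl⟩ ⟨b', rfl⟩
    exact (contDiffOn_graphChart_trans b b' (n := 0)).continuousOn

instance : TopologicalSpace OrientedPlane := core.toTopologicalSpace

instance : ChartedSpace Model OrientedPlane := core.toChartedSpace

instance (n : ℕ∞ω) : IsManifold 𝓘(ℝ, Model) n OrientedPlane := by
  apply isManifold_of_contDiffOn
  intro e e' he he'
  obtain ⟨c, hc, he⟩ := mem_iUnion₂.1 he
  obtain ⟨c', hc', he'⟩ := mem_iUnion₂.1 he'
  obtain ⟨b, rfl⟩ := hc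
  obtain ⟨b', rfl⟩ := hc'
  rw [mem_singleton_iff] at he he'
  subst he
  subst he'
  simp only [modelWithCornersSelf_coe, modelWithCornersSelf_coe_symm, preimage_id, range_id,
    inter_univ]
  exact contDiffOn_graphChart_trans b b'

/-! ### Tangent vectors of `G(3,7)` as elements of `E* ⊗ V` -/

/-- The orthogonal projection of `ℝ⁷` onto the plane `L`, as a function of `L`. -/
def proj (L : OrientedPlane) : R7 →L[ℝ] R7 := L.plane.starProjection

/-- The fibre at `L` of the canonical bundle `E` is the plane `L` itself. -/
abbrev E (L : OrientedPlane) : Submodule ℝ R7 := L.plane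

/-- The fibre at `L` of the complementary bundle `V = E^⊥`. -/
abbrev V (L : OrientedPlane) : Submodule ℝ R7 := L.planeᗮ

/-- The derivative at `L`, in the direction `ξ`, of the projection onto the plane. -/
def dproj (L : OrientedPlane) : TangentSpace 𝓘(ℝ, Model) L →L[ℝ] (R7 →L[ℝ] R7) :=
  mfderiv 𝓘(ℝ, Model) 𝓘(ℝ, R7 →L[ℝ] R7) proj L

/-- The homomorphism `E_L → V_L` defined by a tangent vector `ξ` of `G(3,7)` at `L`. It sends `x`
to the normal component of the derivative of the projection of `x` onto the moving plane.
If the plane moves along a curve `L(t)` and `e(t) ∈ L(t)`, then differentiating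
`proj (L(t)) (e(t)) = e(t)` shows that `e(0)` is sent to the component of `e'(0)` orthogonal to
`L(0)`, which is the usual identification. -/
def tangentToHom (L : OrientedPlane) : TangentSpace 𝓘(ℝ, Model) L →ₗ[ℝ] (L.E →ₗ[ℝ] L.V) where
  toFun ξ := L.V.orthogonalProjectionOnto.toLinearMap ∘ₗ (dproj L ξ).toLinearMap ∘ₗ L.E.subtype
  map_add' ξ η := by
    ext x
    simp
  map_smul' c ξ := by
    ext x
    simp

/-- The canonical map `T_L G(3,7) → E_L* ⊗ V_L`. -/
def tangentToTensor (L : OrientedPlane) :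
    TangentSpace 𝓘(ℝ, Model) L →ₗ[ℝ] Dual ℝ L.E ⊗[ℝ] L.V :=
  (dualTensorHomEquiv ℝ L.E L.V).symm.toLinearMap ∘ₗ tangentToHom L

/-- The oriented plane `L` is associative: `φ₀` restricted to `L` is the volume form of `L`. -/
def IsAssociative (L : OrientedPlane) : Prop :=
  phi0.compLinearMap L.plane.subtype = L.orientation.volumeForm

end OrientedPlane

open OrientedPlane

/-! ### The associative Grassmannian and its normal bundle -/

/-- The set of associative `3`-planes in `G(3,7)`, with the subspace topology. -/
abbrev AssociativeGrassmannian : Type := {L : OrientedPlane // L.IsAssociative}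

section Submanifold

variable [ChartedSpace (EuclideanSpace ℝ (Fin 8)) AssociativeGrassmannian]

/-- The tangent space at `L` of the associative Grassmannian, inside `T_L G(3,7)`: the image of
the differential of the inclusion. -/
def assocTangent (L : AssociativeGrassmannian) :
    Submodule ℝ (TangentSpace 𝓘(ℝ, Model) L.1) :=
  LinearMap.range (mfderiv (𝓡 8) 𝓘(ℝ, Model)
    (Subtype.val : AssociativeGrassmannian → OrientedPlane) L).toLinearMap

/-- The fibre at `L` of the normal bundle of the associative Grassmannian in `G(3,7)`. -/
abbrev AssocNormalSpace (L : AssociativeGrassmannian) : Type :=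
  TangentSpace 𝓘(ℝ, Model) L.1 ⧸ assocTangent L

open scoped Classical in
/-- For a family of linear maps `Φ L : N_L → V_L` on the fibres of the normal bundle, the map on
`TG(3,7)` which sends a tangent vector at an associative plane `L` to the image under `Φ L` of its
class; the value at all other tangent vectors is irrelevant. -/
def normalMapLift (Φ : ∀ L : AssociativeGrassmannian, AssocNormalSpace L ≃ₗ[ℝ] L.1.V)
    (p : TangentBundle 𝓘(ℝ, Model) OrientedPlane) : R7 :=
  if h : p.proj.IsAssociative then Φ ⟨p.proj, h⟩ (Submodule.Quotient.mk p.snd) else 0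

/-- An isomorphism of smooth vector bundles over the associative Grassmannian, from its normal
bundle `N = TG(3,7)| / T` to the restriction of `V`, a subbundle of the trivial bundle with
fibre `ℝ⁷`. It is a family of linear isomorphisms of the fibres that depends smoothly on the base
point. The quotient map `q : TG(3,7)| → N` is a surjective submersion, so that the family is a
smooth map on `N` exactly if its composition with `q` is smooth on `TG(3,7)|`; and a smooth bundle
map which is bijective on every fibre has a smooth inverse. -/
structure NormalBundleIso where
  /-- the isomorphism of the fibres over `L` -/
  toEquiv : ∀ L : AssociativeGrassmannian, AssocNormalSpace L ≃ₗ[ℝ] L.1.V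
  /-- it depends smoothly on the base point -/
  contMDiffOn : ContMDiffOn 𝓘(ℝ, Model).tangent 𝓘(ℝ, R7) ∞ (normalMapLift toEquiv)
    {p : TangentBundle 𝓘(ℝ, Model) OrientedPlane | p.proj.IsAssociative}

end Submanifold

end

/-!
For linearly independent `u, v` in `L`, the plane `L` is associative iff it contains `u × v` and
`u, v, u × v` is positively oriented. For the graph of a homomorphism `A : ℝ³ → ℝ⁴` this says that
the third column of `A` is a certain smooth function of the other two, so that a shear of the graph
chart straightens the associative planes to an `8`-dimensional slice.

Let `P` be the orthogonal projection onto the plane. On associative planes `P(u) × P(v)` lies in the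
plane, and differentiating this relation shows that a tangent vector `ξ` of the associative
Grassmannian satisfies `ξ(u × v) = ξ(u) × v + u × ξ(v)`; for an orthonormal basis with
`e₃ = e₁ × e₂`, it follows that `∑ eⱼ × ξ(eⱼ) = 0`. The map `ξ ↦ ∑ eⱼ × ξ(eⱼ)` onto `L^⊥` has a
kernel of dimension `12 - 4 = 8`, which is therefore the tangent space, and it induces the
isomorphism of the normal bundle with `V`. It is the trace over `ℝ⁷` of `x ↦ x × ξ(P x)`, hence
independent of the basis and smooth in `L`.
-/

noncomputable section

/-! ### Algebra of the cross product -/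

theorem cross_add_left (u u' v : R7) : cross (u + u') v = cross u v + cross u' v :=
  ext_inner_right ℝ fun w => by
    simp only [inner_cross, inner_add_left, AlternatingMap.map_vecCons_add]

theorem cross_smul_left (c : ℝ) (u v : R7) : cross (c • u) v = c • cross u v :=
  ext_inner_right ℝ fun w => by
    simp only [inner_cross, real_inner_smul_left, AlternatingMap.map_vecCons_smul, smul_eq_mul]

theorem cross_swap (u v : R7) : cross u v = -cross v u :=
  ext_inner_right ℝ fun w => by
    rw [inner_neg_left, inner_cross, inner_cross, ← phi0.map_swap _ (zero_ne_one (α := Fin 3))]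
    congr 1
    ext i
    fin_cases i <;> rfl

theorem cross_self_eq_zero (u : R7) : cross u u = 0 :=
  ext_inner_right ℝ fun w => by
    rw [inner_cross, inner_zero_left]
    exact phi0.map_eq_zero_of_eq _ (i := 0) (j := 1) rfl zero_ne_one

theorem inner_cross_left (u v : R7) : inner ℝ u (cross u v) = 0 := by
  rw [real_inner_comm, inner_cross]
  exact phi0.map_eq_zero_of_eq _ (i := 0) (j := 2) rfl (by decide)

theorem inner_cross_right (u v : R7) : inner ℝ v (cross u v) = 0 := by
  rw [cross_swap, inner_neg_right, inner_cross_left, neg_zero]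

theorem inner_cross_swap (u v w : R7) : inner ℝ (cross u v) w = -inner ℝ v (cross u w) := by
  rw [real_inner_comm (cross u w), inner_cross, inner_cross,
    ← phi0.map_swap _ (show (1 : Fin 3) ≠ 2 by decide)]
  congr 1
  ext i
  fin_cases i <;> rfl

/-- The cross product as a bilinear map. -/
def crossLin : R7 →ₗ[ℝ] R7 →ₗ[ℝ] R7 :=
  LinearMap.mk₂ ℝ cross cross_add_left cross_smul_left
    (fun u v v' => by
      rw [cross_swap, cross_add_left, cross_swap u v, cross_swap u v', neg_add])
    (fun c u v => by rw [cross_swap, cross_smul_left, cross_swap u v, smul_neg])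

@[simp] theorem crossLin_apply (u v : R7) : crossLin u v = cross u v := rfl

theorem cross_add_right (u v v' : R7) : cross u (v + v') = cross u v + cross u v' :=
  map_add (crossLin u) v v'

theorem cross_smul_right (c : ℝ) (u v : R7) : cross u (c • v) = c • cross u v :=
  map_smul (crossLin u) c v

theorem cross_zero_right (u : R7) : cross u 0 = 0 := map_zero (crossLin u)

theorem cross_neg_left (u v : R7) : cross (-u) v = -cross u v := crossLin.map_neg₂ u v

theorem cross_neg_right (u v : R7) : cross u (-v) = -cross u v := map_neg (crossLin u) v

theorem wedge3_apply (i j k : Fin 7) (u v w : R7) : wedge3 i j k ![u, v, w] =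
    !![u i, u j, u k; v i, v j, v k; w i, w j, w k].det := by
  change Matrix.det (_ : Matrix (Fin 3) (Fin 3) ℝ) = _
  congr 1
  ext a c
  fin_cases a <;> fin_cases c <;> rfl

theorem cross_eq_vec (u v : R7) : cross u v = !₂[
    u 1 * v 2 - u 2 * v 1 + (u 3 * v 4 - u 4 * v 3) + (u 5 * v 6 - u 6 * v 5),
    u 2 * v 0 - u 0 * v 2 + (u 3 * v 5 - u 5 * v 3) - (u 4 * v 6 - u 6 * v 4),
    u 0 * v 1 - u 1 * v 0 - (u 3 * v 6 - u 6 * v 3) - (u 4 * v 5 - u 5 * v 4),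
    u 4 * v 0 - u 0 * v 4 + (u 5 * v 1 - u 1 * v 5) - (u 6 * v 2 - u 2 * v 6),
    u 0 * v 3 - u 3 * v 0 - (u 6 * v 1 - u 1 * v 6) - (u 5 * v 2 - u 2 * v 5),
    u 6 * v 0 - u 0 * v 6 + (u 1 * v 3 - u 3 * v 1) - (u 2 * v 4 - u 4 * v 2),
    u 0 * v 5 - u 5 * v 0 - (u 1 * v 4 - u 4 * v 1) - (u 2 * v 3 - u 3 * v 2)] := by
  ext k
  fin_cases k <;> simp [cross, phi0, wedge3_apply, Matrix.det_fin_three] <;> ring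

theorem cross_cross_self (u v : R7) :
    cross u (cross u v) = inner ℝ u v • u - inner ℝ u u • v := by
  rw [PiLp.inner_apply, PiLp.inner_apply]
  ext k
  fin_cases k <;> simp [cross_eq_vec, Fin.sum_univ_seven] <;> ring

theorem cross_cross_add (u v w : R7) : cross u (cross v w) + cross v (cross u w) =
    inner ℝ u w • v + inner ℝ v w • u - (2 * inner ℝ u v) • w := by
  have h := cross_cross_self (u + v) w
  simp only [cross_add_left, cross_add_right, cross_cross_self, inner_add_left,
    inner_add_right, real_inner_comm u v] at h
  linear_combination (norm := module) h

theorem cross_cross_of_orthogonal {u v w : R7} (huv : inner ℝ u v = 0) (huw : inner ℝ u w = 0)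
    (hvw : inner ℝ v w = 0) : cross u (cross v w) = -cross v (cross u w) := by
  have h := cross_cross_add u v w
  rw [huv, huw, hvw] at h
  exact eq_neg_of_add_eq_zero_left (by simpa using h)

theorem cross_cross_assoc_of_orthogonal {u v w : R7} (huv : inner ℝ u v = 0)
    (huw : inner ℝ u w = 0) (hvw : inner ℝ v w = 0) :
    cross (cross u v) w = -cross u (cross v w) := by
  rw [cross_swap, cross_cross_of_orthogonal (by rwa [real_inner_comm])
    (by rwa [real_inner_comm]) huv, cross_swap w v, cross_neg_right, neg_neg]

theorem inner_cross_cross_self (u v : R7) : inner ℝ (cross u v) (cross u v) =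
    inner ℝ u u * inner ℝ v v - inner ℝ u v ^ 2 := by
  rw [inner_cross_swap, cross_cross_self, inner_sub_right, real_inner_smul_right,
    real_inner_smul_right, real_inner_comm u v]
  ring

theorem norm_cross_of_inner_eq_zero {u v : R7} (h : inner ℝ u v = 0) :
    ‖cross u v‖ = ‖u‖ * ‖v‖ := by
  rw [← sq_eq_sq₀ (norm_nonneg _) (by positivity), mul_pow]
  simp only [← real_inner_self_eq_norm_sq, inner_cross_cross_self, h]
  ring

theorem cross_ne_zero_of_linearIndependent {u v : R7} (h : LinearIndependent ℝ ![u, v]) :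
    cross u v ≠ 0 := by
  intro h0
  have hrel : inner ℝ u v • u + -inner ℝ u u • v = 0 := by
    rw [neg_smul, ← sub_eq_add_neg, ← cross_cross_self, h0, cross_zero_right]
  have huu := (LinearIndependent.pair_iff.1 h _ _ hrel).2
  exact h.ne_zero 0 (inner_self_eq_zero.1 (neg_eq_zero.1 huu))

/-! ### Alternating maps -/

theorem alternatingMap_update_sum_smul {R M N ι : Type*} [Semiring R] [AddCommMonoid M]
    [AddCommMonoid N] [Module R M] [Module R N] [Fintype ι] [DecidableEq ι] (η : M [⋀^ι]→ₗ[R] N)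
    (v : ι → M) (i : ι) (c : ι → R) :
    η (Function.update v i (∑ j, c j • v j)) = c i • η v := by
  rw [η.map_update_sum, Finset.sum_eq_single i, η.map_update_smul, Function.update_eq_self]
  · intro j _ hji
    rw [η.map_update_smul, η.map_update_self _ hji.symm, smul_zero]
  · simp

theorem alternatingMap_eq_iff_apply_eq {R M ι : Type*} [CommRing R] [IsDomain R] [AddCommGroup M]
    [Module R M] [Finite ι] (b : Basis ι R M) {η θ : M [⋀^ι]→ₗ[R] R}
    {v : ι → M} (hv : θ v ≠ 0) : η = θ ↔ η v = θ v := by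
  classical
  cases nonempty_fintype ι
  refine ⟨fun h => h ▸ rfl, fun h => ?_⟩
  rw [η.eq_smul_basis_det b, θ.eq_smul_basis_det b] at h
  rw [θ.eq_smul_basis_det b] at hv
  rw [η.eq_smul_basis_det b, θ.eq_smul_basis_det b,
    mul_right_cancel₀ (right_ne_zero_of_mul hv) h]

/-! ### Associative planes -/

theorem phi0_eq_inner_cross (v : Fin 3 → R7) : phi0 v = inner ℝ (cross (v 0) (v 1)) (v 2) := by
  rw [inner_cross]
  congr 1
  ext i
  fin_cases i <;> rfl

theorem cross_zero_two_of_orthonormal {e : Fin 3 → R7} (he : Orthonormal ℝ e)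
    (h : cross (e 0) (e 1) = e 2) : cross (e 0) (e 2) = -e 1 := by
  simp [← h, cross_cross_self, orthonormal_iff_ite.1 he, he.1]

theorem cross_one_two_of_orthonormal {e : Fin 3 → R7} (he : Orthonormal ℝ e)
    (h : cross (e 0) (e 1) = e 2) : cross (e 1) (e 2) = e 0 := by
  simp [← h, cross_swap (e 0), cross_neg_right, cross_cross_self, orthonormal_iff_ite.1 he, he.1]

theorem cross_mem_span_of_orthonormal {e : Fin 3 → R7} (he : Orthonormal ℝ e)
    (h : cross (e 0) (e 1) = e 2) {u v : R7} (hu : u ∈ Submodule.span ℝ (range e))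
    (hv : v ∈ Submodule.span ℝ (range e)) : cross u v ∈ Submodule.span ℝ (range e) := by
  have hmem : ∀ i, e i ∈ Submodule.span ℝ (range e) := fun i => Submodule.subset_span ⟨i, rfl⟩
  have hlt : ∀ i j, i < j → cross (e i) (e j) ∈ Submodule.span ℝ (range e) := by
    intro i j hij
    fin_cases i <;> fin_cases j <;> simp [h, hmem,
      cross_zero_two_of_orthonormal he h, cross_one_two_of_orthonormal he h] at hij ⊢
  have hmap : Submodule.map₂ crossLin (Submodule.span ℝ (range e)) (Submodule.span ℝ (range e)) ≤
      Submodule.span ℝ (range e) := by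
    rw [Submodule.map₂_span_span, Submodule.span_le]
    rintro _ ⟨_, ⟨i, rfl⟩, _, ⟨j, rfl⟩, rfl⟩
    rcases lt_trichotomy i j with hij | rfl | hij
    · exact hlt i j hij
    · simp [cross_self_eq_zero]
    · simpa [cross_swap (e i)] using hlt j i hij
  exact hmap (Submodule.apply_mem_map₂ crossLin hu hv)

namespace OrientedPlane

/-- A positively oriented orthonormal basis of an oriented plane. -/
def frame (L : OrientedPlane) : OrthonormalBasis (Fin 3) ℝ L.plane :=
  L.orientation.finOrthonormalBasis (by norm_num) L.finrank_eq

theorem volumeForm_eq_det_frame (L : OrientedPlane) :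
    L.orientation.volumeForm = L.frame.toBasis.det :=
  L.orientation.volumeForm_robust _ (L.orientation.finOrthonormalBasis_orientation _ _)

theorem volumeForm_frame (L : OrientedPlane) : L.orientation.volumeForm L.frame = 1 := by
  rw [volumeForm_eq_det_frame, ← L.frame.coe_toBasis, Basis.det_self]

theorem volumeForm_pos_iff (L : OrientedPlane) (b : Basis (Fin 3) ℝ L.plane) :
    0 < L.orientation.volumeForm b ↔ L.orientation = b.orientation := by
  rw [volumeForm_eq_det_frame, ← Basis.orientation_eq_iff_det_pos, frame,
    Orientation.finOrthonormalBasis_orientation]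

theorem isAssociative_iff_apply (L : OrientedPlane) {v : Fin 3 → L.plane}
    (hv : L.orientation.volumeForm v ≠ 0) :
    L.IsAssociative ↔ inner ℝ (cross (v 0) (v 1)) (v 2 : R7) = L.orientation.volumeForm v := by
  rw [IsAssociative, alternatingMap_eq_iff_apply_eq L.frame.toBasis hv,
    ← phi0_eq_inner_cross fun i => (v i : R7)]
  rfl

theorem IsAssociative.inner_cross_eq_volumeForm {L : OrientedPlane} (h : L.IsAssociative)
    (v : Fin 3 → L.plane) :
    inner ℝ (cross (v 0) (v 1)) (v 2 : R7) = L.orientation.volumeForm v := by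
  rw [← h, ← phi0_eq_inner_cross fun i => (v i : R7)]
  rfl

theorem orthonormal_coe_frame (L : OrientedPlane) : Orthonormal ℝ fun i => (L.frame i : R7) :=
  L.frame.orthonormal.comp_linearIsometry L.plane.subtypeₗᵢ

theorem span_coe_frame (L : OrientedPlane) :
    Submodule.span ℝ (range fun i => (L.frame i : R7)) = L.plane := by
  have h := congrArg (Submodule.map L.plane.subtype) L.frame.toBasis.span_eq
  rwa [Submodule.map_span, ← range_comp, Submodule.map_subtype_top,
    L.frame.coe_toBasis] at h

theorem IsAssociative.cross_frame {L : OrientedPlane} (h : L.IsAssociative) :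
    cross (L.frame 0) (L.frame 1) = L.frame 2 := by
  have he := L.orthonormal_coe_frame
  have hnorm : ‖cross (L.frame 0) (L.frame 1)‖ = 1 := by
    rw [norm_cross_of_inner_eq_zero (he.2 zero_ne_one), he.1, he.1, one_mul]
  rw [← inner_eq_one_iff_of_norm_eq_one (𝕜 := ℝ) hnorm (he.1 2),
    h.inner_cross_eq_volumeForm, volumeForm_frame]

theorem IsAssociative.cross_mem {L : OrientedPlane} (h : L.IsAssociative) {u v : R7}
    (hu : u ∈ L.plane) (hv : v ∈ L.plane) : cross u v ∈ L.plane := by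
  rw [← L.span_coe_frame] at hu hv ⊢
  exact cross_mem_span_of_orthonormal L.orthonormal_coe_frame h.cross_frame hu hv

theorem isAssociative_of_inner_eq_zero {L : OrientedPlane} {u v w : L.plane}
    (huv : inner ℝ (u : R7) v = 0) (hw : (w : R7) = cross u v)
    (hpos : 0 < L.orientation.volumeForm ![u, v, w]) : L.IsAssociative := by
  have huw : inner ℝ (u : R7) w = 0 := by rw [hw, inner_cross_left]
  have hvw : inner ℝ (v : R7) w = 0 := by rw [hw, inner_cross_right]
  have horth : Pairwise fun i j => inner ℝ (![u, v, w] i) (![u, v, w] j) = 0 := by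
    intro i j hij
    fin_cases i <;> fin_cases j <;>
      simp [huv, huw, hvw, inner_eq_zero_symm.1 huv, inner_eq_zero_symm.1 huw,
        inner_eq_zero_symm.1 hvw] at hij ⊢
  have hvol := L.orientation.abs_volumeForm_apply_of_pairwise_orthogonal horth
  rw [abs_of_pos hpos, Fin.prod_univ_three] at hvol
  rw [isAssociative_iff_apply L hpos.ne', hvol]
  change inner ℝ (cross u v) (w : R7) = ‖(u : R7)‖ * ‖(v : R7)‖ * ‖(w : R7)‖
  rw [hw, ← norm_cross_of_inner_eq_zero huv, real_inner_self_eq_norm_mul_norm]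

theorem isAssociative_iff_exists_cross {L : OrientedPlane} {u v : L.plane}
    (huv : LinearIndependent ℝ ![(u : R7), (v : R7)]) :
    L.IsAssociative ↔
      ∃ w : L.plane, (w : R7) = cross u v ∧ 0 < L.orientation.volumeForm ![u, v, w] := by
  constructor
  · intro h
    refine ⟨⟨cross u v, h.cross_mem u.2 v.2⟩, rfl, ?_⟩
    rw [← h.inner_cross_eq_volumeForm]
    exact real_inner_self_pos.2 (cross_ne_zero_of_linearIndependent huv)
  · rintro ⟨w, hw, hpos⟩
    have hu : inner ℝ (u : R7) u ≠ 0 := inner_self_ne_zero.2 (huv.ne_zero 0)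
    set t : ℝ := inner ℝ (u : R7) v / inner ℝ (u : R7) u with ht
    refine isAssociative_of_inner_eq_zero (u := u) (v := v - t • u) (w := w) ?_ ?_ ?_
    · rw [Submodule.coe_sub, Submodule.coe_smul, inner_sub_right, real_inner_smul_right, ht,
        div_mul_cancel₀ _ hu, sub_self]
    · rw [hw, Submodule.coe_sub, Submodule.coe_smul, sub_eq_add_neg, cross_add_right,
        cross_neg_right, cross_smul_right, cross_self_eq_zero, smul_zero, neg_zero, add_zero]
    · have hshear : ![u, v - t • u, w] =
          Function.update ![u, v, w] 1 (∑ j, ![-t, 1, 0] j • ![u, v, w] j) := by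
        ext j
        fin_cases j <;> simp [Fin.sum_univ_three, sub_eq_neg_add]
      rw [hshear, alternatingMap_update_sum_smul]
      simpa using hpos

/-- The isomorphism of `ℝ³` with its image under an injective linear map. -/
def rangeEquiv (f : (Fin 3 → ℝ) →ₗ[ℝ] R7) (hf : Function.Injective f) :
    (Fin 3 → ℝ) ≃ₗ[ℝ] (ofInjective f hf).plane :=
  LinearEquiv.ofInjective f hf

/-- The image of the standard basis of `ℝ³` under an injective linear map, as a basis of the
range. -/
def rangeBasis (f : (Fin 3 → ℝ) →ₗ[ℝ] R7) (hf : Function.Injective f) :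
    Basis (Fin 3) ℝ (ofInjective f hf).plane :=
  (Pi.basisFun ℝ (Fin 3)).map (rangeEquiv f hf)

theorem coe_rangeBasis (f : (Fin 3 → ℝ) →ₗ[ℝ] R7) (hf : Function.Injective f) (i : Fin 3) :
    (rangeBasis f hf i : R7) = f (Pi.single i 1) := by
  rw [rangeBasis, Basis.map_apply, Pi.basisFun_apply]
  rfl

theorem coe_rangeBasis_equivFun_symm (f : (Fin 3 → ℝ) →ₗ[ℝ] R7) (hf : Function.Injective f)
    (x : Fin 3 → ℝ) : ((rangeBasis f hf).equivFun.symm x : R7) = f x := rfl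

theorem volumeForm_rangeBasis_pos (f : (Fin 3 → ℝ) →ₗ[ℝ] R7) (hf : Function.Injective f) :
    0 < (ofInjective f hf).orientation.volumeForm (rangeBasis f hf) := by
  rw [volumeForm_pos_iff, rangeBasis, Basis.orientation_map]
  rfl

theorem isAssociative_ofInjective_iff (f : (Fin 3 → ℝ) →ₗ[ℝ] R7) (hf : Function.Injective f) :
    (ofInjective f hf).IsAssociative ↔
      ∃ x : Fin 3 → ℝ, f x = cross (f (Pi.single 0 1)) (f (Pi.single 1 1)) ∧ 0 < x 2 := by
  set b := rangeBasis f hf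
  have hind : LinearIndependent ℝ ![(b 0 : R7), (b 1 : R7)] := by
    have h := b.linearIndependent.map' _ (ofInjective f hf).plane.ker_subtype
    rw [LinearIndependent.pair_iff]
    intro s t hst
    have := Fintype.linearIndependent_iff.1 h ![s, t, 0] (by simpa [Fin.sum_univ_three] using hst)
    exact ⟨this 0, this 1⟩
  rw [isAssociative_iff_exists_cross hind, b.equivFun.symm.surjective.exists]
  refine exists_congr fun x => ?_
  have hvol : ![b 0, b 1, b.equivFun.symm x] = Function.update b 2 (∑ j, x j • b j) := by
    ext j
    fin_cases j <;> simp [Basis.equivFun_symm_apply]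
  rw [hvol, alternatingMap_update_sum_smul, smul_eq_mul,
    mul_pos_iff_of_pos_right (volumeForm_rangeBasis_pos f hf), coe_rangeBasis_equivFun_symm,
    coe_rangeBasis, coe_rangeBasis]

end OrientedPlane

/-! ### Subsets of a manifold with slice charts -/

section Slice

variable {𝕜 : Type*} [NontriviallyNormedField 𝕜]
  {E F G : Type*} [NormedAddCommGroup E] [NormedSpace 𝕜 E] [NormedAddCommGroup F] [NormedSpace 𝕜 F]
  [NormedAddCommGroup G] [NormedSpace 𝕜 G]
  {N : Type*} [TopologicalSpace N] [ChartedSpace G N]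

variable (𝕜 E F G) in
/-- Slice charts for a subset `S` of a manifold `N`: around every point of `S` there is a chart of
`N` in which `S` is the intersection of the target with the linear subspace `E × 0`. -/
structure SliceAtlas (n : ℕ∞ω) (S : Set N) where
  /-- the splitting of the model space -/
  equiv : (E × F) ≃L[𝕜] G
  /-- the chart around a point -/
  chart : S → OpenPartialHomeomorph N G
  mem_source : ∀ x : S, (x : N) ∈ (chart x).source
  mem_maximalAtlas : ∀ x, chart x ∈ IsManifold.maximalAtlas 𝓘(𝕜, G) n N
  mem_iff : ∀ x, ∀ p ∈ (chart x).source, p ∈ S ↔ (equiv.symm (chart x p)).2 = 0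

namespace SliceAtlas

variable {n : ℕ∞ω} {S : Set N} (A : SliceAtlas 𝕜 E F G n S)

theorem equiv_fst_zero (x p : S) (hp : (p : N) ∈ (A.chart x).source) :
    A.equiv ((A.equiv.symm (A.chart x p)).1, 0) = A.chart x p := by
  rw [← (A.mem_iff x p hp).1 p.2, Prod.mk.eta, ContinuousLinearEquiv.apply_symm_apply]

theorem symm_mem (x : S) {u : E} (hu : A.equiv (u, 0) ∈ (A.chart x).target) :
    (A.chart x).symm (A.equiv (u, 0)) ∈ S := by
  rw [A.mem_iff x _ ((A.chart x).map_target hu), (A.chart x).right_inv hu]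
  simp

open scoped Classical in
/-- The chart of `S` induced by a slice chart. -/
def subtypeChart (x : S) : OpenPartialHomeomorph S E where
  toFun p := (A.equiv.symm (A.chart x p)).1
  invFun u := if h : (A.chart x).symm (A.equiv (u, 0)) ∈ S then ⟨_, h⟩ else x
  source := Subtype.val ⁻¹' (A.chart x).source
  target := {u | A.equiv (u, 0) ∈ (A.chart x).target}
  map_source' p hp := by
    rw [mem_ofPred_eq, A.equiv_fst_zero x p hp]
    exact (A.chart x).map_source hp
  map_target' u hu := by
    rw [dif_pos (A.symm_mem x hu)]
    exact (A.chart x).map_target hu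
  left_inv' p hp := by
    have h : (A.chart x).symm (A.equiv ((A.equiv.symm (A.chart x p)).1, 0)) = p := by
      rw [A.equiv_fst_zero x p hp, (A.chart x).left_inv hp]
    rw [dif_pos (by rw [h]; exact p.2)]
    exact Subtype.ext h
  right_inv' u hu := by
    rw [dif_pos (A.symm_mem x hu), (A.chart x).right_inv hu]
    simp
  open_source := (A.chart x).open_source.preimage continuous_subtype_val
  open_target := (A.chart x).open_target.preimage (by fun_prop)
  continuousOn_toFun := by
    have : ContinuousOn (fun p : S => A.chart x p) (Subtype.val ⁻¹' (A.chart x).source) :=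
      (A.chart x).continuousOn.comp continuous_subtype_val.continuousOn fun _ h => h
    exact (continuous_fst.comp A.equiv.symm.continuous).comp_continuousOn this
  continuousOn_invFun := by
    rw [Topology.IsInducing.subtypeVal.continuousOn_iff]
    have : ContinuousOn (fun u : E => (A.chart x).symm (A.equiv (u, 0)))
        {u | A.equiv (u, 0) ∈ (A.chart x).target} :=
      (A.chart x).continuousOn_symm.comp (by fun_prop) fun _ h => h
    refine this.congr fun u hu => ?_
    simp only [Function.comp_apply]
    rw [dif_pos (A.symm_mem x hu)]

theorem coe_subtypeChart_symm (x : S) {u : E} (hu : u ∈ (A.subtypeChart x).target) :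
    ((A.subtypeChart x).symm u : N) = (A.chart x).symm (A.equiv (u, 0)) := by
  have : (A.subtypeChart x).symm u = ⟨_, A.symm_mem x hu⟩ := dif_pos (A.symm_mem x hu)
  rw [this]

/-- The charted space structure of a subset with slice charts. -/
@[reducible] def chartedSpace : ChartedSpace E S where
  atlas := range A.subtypeChart
  chartAt := A.subtypeChart
  mem_chart_source x := A.mem_source x
  chart_mem_atlas x := mem_range_self x

theorem isManifold : letI := A.chartedSpace; IsManifold 𝓘(𝕜, E) n S := by
  let := A.chartedSpace
  apply isManifold_of_contDiffOn
  rintro _ _ ⟨x, rfl⟩ ⟨y, rfl⟩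
  simp only [modelWithCornersSelf_coe, modelWithCornersSelf_coe_symm, preimage_id, range_id,
    inter_univ, Function.comp_id, Function.id_comp]
  have htransition := (contMDiffOn_of_mem_maximalAtlas (A.mem_maximalAtlas y)).comp'
    (contMDiffOn_symm_of_mem_maximalAtlas (A.mem_maximalAtlas x))
  rw [contMDiffOn_iff_contDiffOn] at htransition
  have hslice : ContDiffOn 𝕜 n (fun u : E => (A.equiv.symm (((A.chart y) ∘ (A.chart x).symm)
      (A.equiv (u, 0)))).1) ((A.subtypeChart x).symm.trans (A.subtypeChart y)).source := by
    refine (contDiff_fst.comp A.equiv.symm.contDiff).comp_contDiffOn (htransition.comp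
      (A.equiv.contDiff.comp (contDiff_id.prodMk contDiff_const)).contDiffOn fun u hu => ?_)
    have hmem : ((A.subtypeChart x).symm u : N) ∈ (A.chart y).source := hu.2
    rw [A.coe_subtypeChart_symm x hu.1] at hmem
    exact ⟨hu.1, hmem⟩
  refine hslice.congr fun u hu => ?_
  change (A.equiv.symm (A.chart y ((A.subtypeChart x).symm u : N))).1 = _
  rw [A.coe_subtypeChart_symm x hu.1]
  rfl

theorem isImmersionOfComplement : letI := A.chartedSpace
    Manifold.IsImmersionOfComplement F 𝓘(𝕜, E) 𝓘(𝕜, G) n (Subtype.val : S → N) := by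
  let := A.chartedSpace
  have := A.isManifold
  intro x
  refine Manifold.IsImmersionAtOfComplement.mk_of_charts A.equiv (A.subtypeChart x) (A.chart x)
    (A.mem_source x) (A.mem_source x) (IsManifold.chart_mem_maximalAtlas x)
    (A.mem_maximalAtlas x) (fun p hp => hp) fun u hu => ?_
  have hu : u ∈ (A.subtypeChart x).target := by simpa using hu
  change A.chart x ((A.subtypeChart x).symm u : N) = A.equiv (u, 0)
  rw [A.coe_subtypeChart_symm x hu]
  exact (A.chart x).right_inv hu

end SliceAtlas

end Slice

/-! ### The differential of an immersion -/

section Immersion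

variable {𝕜 : Type*} [NontriviallyNormedField 𝕜]

theorem mfderiv_injective_of_eventuallyEq_id
    {E H E' H' : Type*} [NormedAddCommGroup E] [NormedSpace 𝕜 E] [TopologicalSpace H]
    {I : ModelWithCorners 𝕜 E H} [NormedAddCommGroup E'] [NormedSpace 𝕜 E'] [TopologicalSpace H']
    {I' : ModelWithCorners 𝕜 E' H'} {M N : Type*} [TopologicalSpace M] [ChartedSpace H M]
    [TopologicalSpace N] [ChartedSpace H' N] {f : M → N} {r : N → M} {x : M}
    (hr : MDifferentiableAt I' I r (f x)) (hf : MDifferentiableAt I I' f x)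
    (hrf : r ∘ f =ᶠ[nhds x] id) : Function.Injective (mfderiv I I' f x) := by
  have hcomp := mfderiv_comp x hr hf
  rw [hrf.mfderiv_eq, mfderiv_id] at hcomp
  exact Function.LeftInverse.injective (g := mfderiv I' I r (f x)) fun v =>
    (DFunLike.congr_fun hcomp v).symm

variable {E F G : Type*} [NormedAddCommGroup E] [NormedSpace 𝕜 E] [NormedAddCommGroup F]
  [NormedSpace 𝕜 F] [NormedAddCommGroup G] [NormedSpace 𝕜 G]
  {M N : Type*} [TopologicalSpace M] [ChartedSpace E M] [TopologicalSpace N] [ChartedSpace G N]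
  {n : ℕ∞ω} {f : M → N} {x : M}

theorem equiv_symm_codChart_apply
    (h : Manifold.IsImmersionAtOfComplement F 𝓘(𝕜, E) 𝓘(𝕜, G) n f x) {p : M}
    (hp : p ∈ h.domChart.source) : h.equiv.symm (h.codChart (f p)) = (h.domChart p, 0) := by
  have hw := h.writtenInCharts (by simpa using h.domChart.map_source hp)
  rw [ContinuousLinearEquiv.symm_apply_eq]
  simpa [h.domChart.left_inv hp] using hw

theorem exists_mdifferentiableAt_leftInverse
    (h : Manifold.IsImmersionAtOfComplement F 𝓘(𝕜, E) 𝓘(𝕜, G) n f x) (hn : n ≠ 0) :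
    ∃ r : N → M, MDifferentiableAt 𝓘(𝕜, G) 𝓘(𝕜, E) r (f x) ∧ r ∘ f =ᶠ[nhds x] id := by
  refine ⟨fun p => h.domChart.symm (h.equiv.symm (h.codChart p)).1, ?_, ?_⟩
  · have hcod : MDifferentiableAt 𝓘(𝕜, G) 𝓘(𝕜, G) h.codChart (f x) :=
      (contMDiffAt_of_mem_maximalAtlas h.codChart_mem_maximalAtlas
        h.mem_codChart_source).mdifferentiableAt hn
    have hfst : MDifferentiableAt 𝓘(𝕜, G) 𝓘(𝕜, E) (fun y : G => (h.equiv.symm y).1)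
        (h.codChart (f x)) :=
      ((ContinuousLinearMap.fst 𝕜 E F).comp
        (h.equiv.symm : G →L[𝕜] E × F)).differentiableAt.mdifferentiableAt
    have hdom : MDifferentiableAt 𝓘(𝕜, E) 𝓘(𝕜, E) h.domChart.symm
        (h.equiv.symm (h.codChart (f x))).1 := by
      rw [equiv_symm_codChart_apply h h.mem_domChart_source]
      exact (contMDiffAt_symm_of_mem_maximalAtlas h.domChart_mem_maximalAtlas
        (h.domChart.map_source h.mem_domChart_source)).mdifferentiableAt hn
    exact hdom.comp (f x) (hfst.comp (f x) hcod)
  · filter_upwards [h.domChart.open_source.mem_nhds h.mem_domChart_source] with p hp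
    simp [equiv_symm_codChart_apply h hp, h.domChart.left_inv hp]

theorem mfderiv_injective_of_isImmersionAtOfComplement
    (h : Manifold.IsImmersionAtOfComplement F 𝓘(𝕜, E) 𝓘(𝕜, G) n f x) (hn : n ≠ 0) :
    Function.Injective (mfderiv 𝓘(𝕜, E) 𝓘(𝕜, G) f x) :=
  have ⟨_, hr, hrf⟩ := exists_mdifferentiableAt_leftInverse h hn
  mfderiv_injective_of_eventuallyEq_id hr (h.contMDiffAt.mdifferentiableAt hn) hrf

end Immersion

/-! ### Slice charts for the associative planes -/

/-- The cross product as a continuous bilinear map. -/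
def crossCLM : R7 →L[ℝ] R7 →L[ℝ] R7 := crossLin.toContinuousBilinearMap

@[simp] theorem crossCLM_apply (u v : R7) : crossCLM u v = cross u v := rfl

theorem contDiff_cross {X : Type*} [NormedAddCommGroup X] [NormedSpace ℝ X] {n : ℕ∞ω}
    {f g : X → R7} (hf : ContDiff ℝ n f) (hg : ContDiff ℝ n g) :
    ContDiff ℝ n fun x => cross (f x) (g x) :=
  (crossCLM.contDiff.comp hf).clm_apply hg

namespace OrientedPlane

/-- The chart of `G(3,7)` given by a splitting, as an open partial homeomorphism. -/
def graphHomeo (b : Splitting) : OpenPartialHomeomorph OrientedPlane Model :=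
  core.openPartialHomeomorph (graphChart b) (mem_range_self b)

theorem graphHomeo_mem_maximalAtlas (b : Splitting) (n : ℕ∞ω) :
    graphHomeo b ∈ IsManifold.maximalAtlas 𝓘(ℝ, Model) n OrientedPlane :=
  IsManifold.subset_maximalAtlas
    (mem_iUnion₂.2 ⟨graphChart b, mem_range_self b, mem_singleton _⟩)

theorem graph_graphHomeo (b : Splitting) {L : OrientedPlane} (hL : L ∈ (graphHomeo b).source) :
    graph b (graphHomeo b L) = L :=
  (graphHomeo b).left_inv hL

theorem apply_eq_sum_single (A : Model) (x : Fin 3 → ℝ) : A x =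
    x 0 • A (Pi.single 0 1) + x 1 • A (Pi.single 1 1) + x 2 • A (Pi.single 2 1) := by
  rw [← map_smul, ← map_smul, ← map_smul, ← map_add, ← map_add]
  congr 1
  ext i
  fin_cases i <;> simp

/-- The cross product of the first two standard spanning vectors of the graph of `A`, in the
coordinates of the splitting. -/
def crossGraph (b : Splitting) (A : Model) : (Fin 3 → ℝ) × (Fin 4 → ℝ) :=
  b.symm (cross (b (Pi.single 0 1, A (Pi.single 0 1))) (b (Pi.single 1 1, A (Pi.single 1 1))))

/-- The vector to which `A` must send the third standard basis vector for its graph to contain the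
cross product of its first two spanning vectors. It depends on the images of the first two basis
vectors only, and is meaningful where `(crossGraph b A).1 2` is positive. -/
def thirdImage (b : Splitting) (A : Model) : Fin 4 → ℝ :=
  ((crossGraph b A).1 2)⁻¹ • ((crossGraph b A).2 - (crossGraph b A).1 0 • A (Pi.single 0 1)
    - (crossGraph b A).1 1 • A (Pi.single 1 1))

theorem isAssociative_graph_iff_crossGraph (b : Splitting) (A : Model) :
    (graph b A).IsAssociative ↔
      A (crossGraph b A).1 = (crossGraph b A).2 ∧ 0 < (crossGraph b A).1 2 := by
  have hcross : ∀ x, graphMap b A x = cross (graphMap b A (Pi.single 0 1))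
      (graphMap b A (Pi.single 1 1)) ↔ (x, A x) = crossGraph b A := fun x => by
    rw [crossGraph, ContinuousLinearEquiv.eq_symm_apply]
    rfl
  simp only [graph, isAssociative_ofInjective_iff, hcross]
  constructor
  · rintro ⟨x, hx, hpos⟩
    rw [← hx]
    exact ⟨rfl, hpos⟩
  · rintro ⟨h, hpos⟩
    exact ⟨_, Prod.ext rfl h, hpos⟩

theorem isAssociative_graph_iff (b : Splitting) (A : Model) : (graph b A).IsAssociative ↔
    0 < (crossGraph b A).1 2 ∧ A (Pi.single 2 1) = thirdImage b A := by
  rw [isAssociative_graph_iff_crossGraph, and_comm]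
  refine and_congr_right fun hpos => ?_
  rw [thirdImage, eq_inv_smul_iff₀ hpos.ne', apply_eq_sum_single, sub_sub, eq_sub_iff_add_eq']

theorem contDiff_crossGraph (b : Splitting) {n : ℕ∞ω} : ContDiff ℝ n (crossGraph b) := by
  refine b.symm.contDiff.comp (contDiff_cross ?_ ?_) <;>
  exact b.contDiff.comp (contDiff_const.prodMk (contDiff_id.clm_apply contDiff_const))

theorem contDiffOn_thirdImage (b : Splitting) {n : ℕ∞ω} :
    ContDiffOn ℝ n (thirdImage b) {A | 0 < (crossGraph b A).1 2} := by
  have hfst : ∀ i, ContDiff ℝ n fun A => (crossGraph b A).1 i := fun i =>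
    contDiff_pi.1 (contDiff_fst.comp (contDiff_crossGraph b)) i
  have happly : ∀ x : Fin 3 → ℝ, ContDiff ℝ n fun A : Model => A x := fun x =>
    contDiff_id.clm_apply contDiff_const
  refine ((hfst 2).contDiffOn.inv fun A hA => (ne_of_gt hA)).smul (ContDiff.contDiffOn ?_)
  exact ((contDiff_snd.comp (contDiff_crossGraph b)).sub ((hfst 0).smul (happly _))).sub
    ((hfst 1).smul (happly _))

/-- The homomorphism which sends the third standard basis vector to `c` and kills the others. -/
def thirdHom : (Fin 4 → ℝ) →L[ℝ] Model :=
  ContinuousLinearMap.smulRightL ℝ _ _ (ContinuousLinearMap.proj 2)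

theorem thirdHom_apply (c : Fin 4 → ℝ) (x : Fin 3 → ℝ) : thirdHom c x = x 2 • c := rfl

theorem crossGraph_add_thirdHom (b : Splitting) (A : Model) (c : Fin 4 → ℝ) :
    crossGraph b (A + thirdHom c) = crossGraph b A := by
  simp [crossGraph, thirdHom_apply]

theorem thirdImage_add_thirdHom (b : Splitting) (A : Model) (c : Fin 4 → ℝ) :
    thirdImage b (A + thirdHom c) = thirdImage b A := by
  simp [thirdImage, crossGraph_add_thirdHom, thirdHom_apply]

theorem contDiffOn_thirdHom_thirdImage (b : Splitting) {n : ℕ∞ω} :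
    ContDiffOn ℝ n (fun A => thirdHom (thirdImage b A)) {A | 0 < (crossGraph b A).1 2} :=
  thirdHom.contDiff.comp_contDiffOn (contDiffOn_thirdImage b)

theorem isOpen_crossGraph_pos (b : Splitting) : IsOpen {A | 0 < (crossGraph b A).1 2} :=
  isOpen_lt continuous_const ((continuous_apply 2).comp
    (continuous_fst.comp (contDiff_crossGraph b (n := 0)).continuous))

/-- The shear of `Hom(ℝ³, ℝ⁴)` which straightens the associative planes: it subtracts the
associative value from the image of the third standard basis vector. -/
def shear (b : Splitting) : OpenPartialHomeomorph Model Model where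
  toFun A := A + thirdHom (-thirdImage b A)
  invFun A := A + thirdHom (thirdImage b A)
  source := {A | 0 < (crossGraph b A).1 2}
  target := {A | 0 < (crossGraph b A).1 2}
  map_source' A hA := by rwa [mem_ofPred_eq, crossGraph_add_thirdHom]
  map_target' A hA := by rwa [mem_ofPred_eq, crossGraph_add_thirdHom]
  left_inv' A _ := by rw [thirdImage_add_thirdHom, map_neg, neg_add_cancel_right]
  right_inv' A _ := by rw [thirdImage_add_thirdHom, map_neg, add_neg_cancel_right]
  open_source := isOpen_crossGraph_pos b
  open_target := isOpen_crossGraph_pos b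
  continuousOn_toFun := by
    simp only [map_neg]
    exact (contDiffOn_id.add (contDiffOn_thirdHom_thirdImage b (n := 0)).neg).continuousOn
  continuousOn_invFun :=
    (contDiffOn_id.add (contDiffOn_thirdHom_thirdImage b (n := 0))).continuousOn

theorem contDiffOn_shear (b : Splitting) {n : ℕ∞ω} : ContDiffOn ℝ n (shear b) (shear b).source := by
  refine (contDiffOn_id.add (contDiffOn_thirdHom_thirdImage b).neg).congr fun A _ => ?_
  simp [shear]

theorem contDiffOn_shear_symm (b : Splitting) {n : ℕ∞ω} :
    ContDiffOn ℝ n (shear b).symm (shear b).target :=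
  contDiffOn_id.add (contDiffOn_thirdHom_thirdImage b)

/-- A chart of `G(3,7)` in which the associative planes form a linear subspace. -/
def straightChart (b : Splitting) : OpenPartialHomeomorph OrientedPlane Model :=
  (graphHomeo b).trans (shear b)

theorem straightChart_mem_maximalAtlas (b : Splitting) (n : ℕ∞ω) :
    straightChart b ∈ IsManifold.maximalAtlas 𝓘(ℝ, Model) n OrientedPlane := by
  have hg := graphHomeo_mem_maximalAtlas b n
  apply OpenPartialHomeomorph.mem_maximalAtlas_of_contMDiffOn
  · exact (contMDiffOn_iff_contDiffOn.2 (contDiffOn_shear b)).comp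
      ((contMDiffOn_of_mem_maximalAtlas hg).mono fun L hL => hL.1) fun L hL => hL.2
  · exact (contMDiffOn_symm_of_mem_maximalAtlas hg).comp
      ((contMDiffOn_iff_contDiffOn.2 (contDiffOn_shear_symm b)).mono fun A hA => hA.1)
      fun A _ => mem_univ _

theorem isAssociative_iff_straightChart (b : Splitting) {L : OrientedPlane}
    (hL : L ∈ (straightChart b).source) :
    L.IsAssociative ↔ straightChart b L (Pi.single 2 1) = 0 := by
  obtain ⟨hgraph, hpos : 0 < (crossGraph b (graphHomeo b L)).1 2⟩ := hL
  conv_lhs => rw [← graph_graphHomeo b hgraph]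
  rw [isAssociative_graph_iff, and_iff_right hpos]
  change _ ↔ (graphHomeo b L + thirdHom (-thirdImage b (graphHomeo b L))) (Pi.single 2 1) = 0
  rw [add_apply, thirdHom_apply, Pi.single_eq_same, one_smul, add_neg_eq_zero]

theorem mem_straightChart_source (b : Splitting) {L : OrientedPlane}
    (hL : L ∈ (graphHomeo b).source) (h : L.IsAssociative) : L ∈ (straightChart b).source := by
  rw [← graph_graphHomeo b hL, isAssociative_graph_iff] at h
  exact ⟨hL, h.1⟩

/-- The images of the standard basis vectors, as linear coordinates on `Hom(ℝ³, ℝ⁴)`. -/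
def imagesEquiv : Model ≃ₗ[ℝ] ((Fin 4 → ℝ) × (Fin 4 → ℝ)) × (Fin 4 → ℝ) where
  toFun A := ((A (Pi.single 0 1), A (Pi.single 1 1)), A (Pi.single 2 1))
  invFun p := (ContinuousLinearMap.proj 0).smulRight p.1.1 +
    (ContinuousLinearMap.proj 1).smulRight p.1.2 + (ContinuousLinearMap.proj 2).smulRight p.2
  map_add' _ _ := rfl
  map_smul' _ _ := rfl
  left_inv A := ContinuousLinearMap.ext fun x => (apply_eq_sum_single A x).symm
  right_inv p := by simp

/-- The splitting of `Hom(ℝ³, ℝ⁴)` into the images of the first two basis vectors and that of the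
third one. -/
def modelEquiv : (EuclideanSpace ℝ (Fin 8) × (Fin 4 → ℝ)) ≃L[ℝ] Model :=
  (((LinearEquiv.ofFinrankEq (EuclideanSpace ℝ (Fin 8)) ((Fin 4 → ℝ) × (Fin 4 → ℝ))
    (by simp)).prodCongr (LinearEquiv.refl ℝ (Fin 4 → ℝ))).trans
      imagesEquiv.symm).toContinuousLinearEquiv

theorem modelEquiv_symm_snd (A : Model) : (modelEquiv.symm A).2 = A (Pi.single 2 1) := rfl

/-- The slice charts of `G(3,7)` for the set of associative planes. -/
def assocSliceAtlas : SliceAtlas ℝ (EuclideanSpace ℝ (Fin 8)) (Fin 4 → ℝ) Model ∞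
    {L : OrientedPlane | L.IsAssociative} where
  equiv := modelEquiv
  chart L := straightChart (exists_mem_graphChart_source L.1).choose
  mem_source L := mem_straightChart_source _ (exists_mem_graphChart_source L.1).choose_spec L.2
  mem_maximalAtlas _ := straightChart_mem_maximalAtlas _ _
  mem_iff _ _ hp := by
    rw [modelEquiv_symm_snd]
    exact isAssociative_iff_straightChart _ hp

end OrientedPlane

/-! ### Smoothness of orthogonal projections -/

section RangeProjection

open ContinuousLinearMap

theorem contDiff_adjoint {X Y : Type*} [NormedAddCommGroup X] [InnerProductSpace ℝ X]
    [CompleteSpace X] [NormedAddCommGroup Y] [InnerProductSpace ℝ Y] [CompleteSpace Y]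
    {n : ℕ∞ω} : ContDiff ℝ n fun M : X →L[ℝ] Y => adjoint M :=
  (IsLinearMap.with_bound ⟨map_add _, fun c M => by simp⟩ 1 fun M => by simp).contDiff

variable {X Y : Type*} [NormedAddCommGroup X] [InnerProductSpace ℝ X] [FiniteDimensional ℝ X]
  [CompleteSpace X] [NormedAddCommGroup Y] [InnerProductSpace ℝ Y] [CompleteSpace Y]

theorem isInvertible_adjoint_comp_self {M : X →L[ℝ] Y} (hM : Function.Injective M) :
    ((adjoint M).comp M).IsInvertible :=
  ⟨(LinearEquiv.ofInjectiveEndo ((adjoint M).comp M).toLinearMap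
    ((adjoint_comp_self_injective_iff M).2 hM)).toContinuousLinearEquiv, rfl⟩

theorem starProjection_range_eq {M : X →L[ℝ] Y} (hM : Function.Injective M) :
    M.range.starProjection = M.comp (((adjoint M).comp M).inverse.comp (adjoint M)) := by
  ext y
  refine Submodule.eq_starProjection_of_mem_of_inner_eq_zero ⟨_, rfl⟩ ?_
  rintro _ ⟨x, rfl⟩
  have normalEquation : adjoint M (M (((adjoint M).comp M).inverse (adjoint M y))) = adjoint M y :=
    (isInvertible_adjoint_comp_self hM).self_apply_inverse _
  change inner ℝ (y - M (((adjoint M).comp M).inverse (adjoint M y))) (M x) = 0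
  rw [← adjoint_inner_left, map_sub, normalEquation, sub_self, inner_zero_left]

theorem contDiff_starProjection_range {Z : Type*} [NormedAddCommGroup Z] [NormedSpace ℝ Z]
    {n : ℕ∞ω} {M : Z → X →L[ℝ] Y} (hM : ContDiff ℝ n M) (hinj : ∀ z, Function.Injective (M z)) :
    ContDiff ℝ n fun z => (M z).range.starProjection := by
  have hadj : ContDiff ℝ n fun z => adjoint (M z) := contDiff_adjoint.comp hM
  have hinv : ContDiff ℝ n fun z => ((adjoint (M z)).comp (M z)).inverse :=
    contDiff_iff_contDiffAt.2 fun z => ContDiffAt.comp (g := inverse) z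
      (isInvertible_adjoint_comp_self (hinj z)).contDiffAt_map_inverse
      (hadj.clm_comp hM).contDiffAt
  simp only [starProjection_range_eq (hinj _)]
  exact hM.clm_comp (hinv.clm_comp hadj)

end RangeProjection

namespace OrientedPlane

/-- The embedding of `ℝ³` onto the graph of `A`, as a map of Euclidean spaces. -/
def graphCLM (b : Splitting) (A : Model) : EuclideanSpace ℝ (Fin 3) →L[ℝ] R7 :=
  (b : _ →L[ℝ] R7).comp (((ContinuousLinearMap.id ℝ _).prod A).comp
    (EuclideanSpace.equiv (Fin 3) ℝ : _ →L[ℝ] _))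

theorem contDiff_graphCLM (b : Splitting) {n : ℕ∞ω} : ContDiff ℝ n (graphCLM b) :=
  contDiff_const.clm_comp (contDiff_id_prod.clm_comp contDiff_const)

theorem graphCLM_injective (b : Splitting) (A : Model) : Function.Injective (graphCLM b A) :=
  (graphMap_injective b A).comp (EuclideanSpace.equiv (Fin 3) ℝ).injective

theorem range_graphCLM (b : Splitting) (A : Model) : (graphCLM b A).range = (graph b A).plane :=
  SetLike.coe_injective ((EuclideanSpace.equiv (Fin 3) ℝ).surjective.range_comp (graphMap b A))

theorem contDiff_proj_graph (b : Splitting) {n : ℕ∞ω} :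
    ContDiff ℝ n fun A => proj (graph b A) := by
  simpa only [proj, range_graphCLM] using
    contDiff_starProjection_range (contDiff_graphCLM b) (graphCLM_injective b)

theorem contMDiff_proj {n : ℕ∞ω} : ContMDiff 𝓘(ℝ, Model) 𝓘(ℝ, R7 →L[ℝ] R7) n proj := by
  intro L
  obtain ⟨b, hb⟩ := exists_mem_graphChart_source L
  have hb : L ∈ (graphHomeo b).source := hb
  have inChart : ContMDiffAt 𝓘(ℝ, Model) 𝓘(ℝ, R7 →L[ℝ] R7) n
      ((fun A => proj (graph b A)) ∘ graphHomeo b) L :=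
    (contDiff_proj_graph b).contMDiff.contMDiffAt.comp L
      (contMDiffAt_of_mem_maximalAtlas (graphHomeo_mem_maximalAtlas b n) hb)
  refine inChart.congr_of_eventuallyEq ?_
  filter_upwards [(graphHomeo b).open_source.mem_nhds hb] with L' hL'
  rw [Function.comp_apply, graph_graphHomeo b hL']

end OrientedPlane

/-! ### The differential of the projection -/

section FixedByFamily

variable {E H F M : Type*} [NormedAddCommGroup E] [NormedSpace ℝ E] [TopologicalSpace H]
  {I : ModelWithCorners ℝ E H} [TopologicalSpace M] [ChartedSpace H M] [NormedAddCommGroup F]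
  [NormedSpace ℝ F] {x : M}

theorem hasMFDerivAt_clm_apply {G : Type*} [NormedAddCommGroup G] [NormedSpace ℝ G]
    {P : M → F →L[ℝ] G} {u : M → F} {P' : E →L[ℝ] F →L[ℝ] G}
    {u' : E →L[ℝ] F} (hP : HasMFDerivAt I 𝓘(ℝ, F →L[ℝ] G) P x P')
    (hu : HasMFDerivAt I 𝓘(ℝ, F) u x u') :
    HasMFDerivAt I 𝓘(ℝ, G) (fun y => P y (u y)) x ((P x).comp u' + P'.flip (u x)) := by
  have hpair : HasMFDerivAt I 𝓘(ℝ, (F →L[ℝ] G) × F) (fun y => (P y, u y)) x (P'.prod u') :=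
    ⟨hP.1.prodMk hu.1, hP.2.prodMk hu.2⟩
  have happly : HasMFDerivAt 𝓘(ℝ, (F →L[ℝ] G) × F) 𝓘(ℝ, G)
      (fun q : (F →L[ℝ] G) × F => q.1 q.2) (P x, u x) _ :=
    (isBoundedBilinearMap_apply.hasFDerivAt (P x, u x)).hasMFDerivAt
  exact HasMFDerivAt.comp x happly hpair

theorem apply_eq_sub_of_hasMFDerivAt_of_apply_eq_self {P : M → F →L[ℝ] F} {u : M → F}
    {P' : E →L[ℝ] F →L[ℝ] F} {u' : E →L[ℝ] F}
    (hP : HasMFDerivAt I 𝓘(ℝ, F →L[ℝ] F) P x P') (hu : HasMFDerivAt I 𝓘(ℝ, F) u x u')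
    (h : ∀ y, P y (u y) = u y) (ξ : E) : P' ξ (u x) = u' ξ - P x (u' ξ) := by
  have hPu := hasMFDerivAt_clm_apply hP hu
  rw [show (fun y => P y (u y)) = u from funext h] at hPu
  exact eq_sub_of_add_eq' (congrArg (· ξ) (hasMFDerivAt_unique hPu hu))

end FixedByFamily

namespace OrientedPlane

/-- The splitting which defines the preferred chart at `L`. -/
def splittingAt (L : OrientedPlane) : Splitting := (exists_mem_graphChart_source L).choose

/-- The coordinate of `L` in its preferred chart. -/
def coordAt (L : OrientedPlane) : Model := graphHomeo (splittingAt L) L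

theorem graph_coordAt (L : OrientedPlane) : graph (splittingAt L) (coordAt L) = L :=
  graph_graphHomeo _ (exists_mem_graphChart_source L).choose_spec

theorem mem_plane_iff (L : OrientedPlane) (u : R7) :
    u ∈ L.plane ↔ ∃ x, splittingAt L (x, coordAt L x) = u := by
  conv_lhs => rw [← graph_coordAt L]
  exact Iff.rfl

theorem proj_of_mem {L : OrientedPlane} {u : R7} (hu : u ∈ L.plane) : proj L u = u :=
  Submodule.starProjection_eq_self_iff.2 hu

theorem proj_of_mem_orthogonal {L : OrientedPlane} {u : R7} (hu : u ∈ L.V) : proj L u = 0 :=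
  (Submodule.starProjection_apply_eq_zero_iff _).2 hu

theorem sub_proj_mem (L : OrientedPlane) (u : R7) : u - proj L u ∈ L.V :=
  Submodule.sub_starProjection_mem_orthogonal u

theorem hasMFDerivAt_proj (L : OrientedPlane) :
    HasMFDerivAt 𝓘(ℝ, Model) 𝓘(ℝ, R7 →L[ℝ] R7) proj L (dproj L) :=
  ((contMDiff_proj (n := 1)).mdifferentiable one_ne_zero L).hasMFDerivAt

theorem hasFDerivAt_proj_graph (L : OrientedPlane) :
    HasFDerivAt (fun A => proj (graph (splittingAt L) A)) (dproj L) (coordAt L) := by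
  have hdproj : dproj L = fderiv ℝ (fun A => proj (graph (splittingAt L) A)) (coordAt L) := by
    rw [dproj, (hasMFDerivAt_proj L).mdifferentiableAt.mfderiv, ModelWithCorners.range_eq_univ,
      fderivWithin_univ]
    rfl
  rw [hdproj]
  exact ((contDiff_proj_graph _ (n := 1)).differentiable one_ne_zero _).hasFDerivAt

theorem dproj_apply_splittingAt (L : OrientedPlane) (ξ : TangentSpace 𝓘(ℝ, Model) L)
    (x : Fin 3 → ℝ) : dproj L ξ (splittingAt L (x, coordAt L x)) =
      splittingAt L (0, (show Model from ξ) x) -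
        proj L (splittingAt L (0, (show Model from ξ) x)) := by
  have hgraph : HasFDerivAt (fun B : Model => splittingAt L (x, B x))
      ((splittingAt L : _ →L[ℝ] R7).comp ((ContinuousLinearMap.inr ℝ (Fin 3 → ℝ) (Fin 4 → ℝ)).comp
        (ContinuousLinearMap.apply ℝ (Fin 4 → ℝ) x))) (coordAt L) :=
    (splittingAt L).hasFDerivAt.comp _ ((hasFDerivAt_prodMk_right x _).comp _
      (ContinuousLinearMap.apply ℝ (Fin 4 → ℝ) x).hasFDerivAt)
  have hderiv := apply_eq_sub_of_hasMFDerivAt_of_apply_eq_self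
    (hasFDerivAt_proj_graph L).hasMFDerivAt
    hgraph.hasMFDerivAt (fun B => proj_of_mem (L := graph _ B) ⟨x, rfl⟩) ξ
  rwa [graph_coordAt] at hderiv

theorem dproj_mem {L : OrientedPlane} (ξ : TangentSpace 𝓘(ℝ, Model) L) {u : R7}
    (hu : u ∈ L.plane) : dproj L ξ u ∈ L.V := by
  obtain ⟨x, rfl⟩ := (mem_plane_iff L u).1 hu
  rw [dproj_apply_splittingAt]
  exact sub_proj_mem L _

theorem coe_tangentToHom (L : OrientedPlane) (ξ : TangentSpace 𝓘(ℝ, Model) L) (u : L.E) :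
    (tangentToHom L ξ u : R7) = dproj L ξ u :=
  Submodule.starProjection_eq_self_iff.2 (dproj_mem ξ u.2)

theorem tangentToHom_injective (L : OrientedPlane) : Function.Injective (tangentToHom L) := by
  refine (injective_iff_map_eq_zero _).2 fun ξ hξ => ContinuousLinearMap.ext fun x => ?_
  have hx : splittingAt L (x, coordAt L x) ∈ L.plane := (mem_plane_iff L _).2 ⟨x, rfl⟩
  have hdproj : dproj L ξ (splittingAt L (x, coordAt L x)) = 0 := by
    rw [← coe_tangentToHom L ξ ⟨_, hx⟩, hξ]
    rfl
  rw [dproj_apply_splittingAt, sub_eq_zero, eq_comm] at hdproj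
  obtain ⟨y, hy⟩ := (mem_plane_iff L _).1 (Submodule.starProjection_eq_self_iff.1 hdproj)
  obtain ⟨rfl, hξx⟩ := Prod.mk.inj ((splittingAt L).injective hy)
  rw [← hξx, map_zero]
  rfl

theorem finrank_V (L : OrientedPlane) : finrank ℝ L.V = 4 := by
  have hadd := L.plane.finrank_add_finrank_orthogonal
  rw [L.finrank_eq, finrank_euclideanSpace_fin] at hadd
  exact Nat.add_left_cancel (hadd.trans (by norm_num : 7 = 3 + 4))

instance (L : OrientedPlane) : FiniteDimensional ℝ (TangentSpace 𝓘(ℝ, Model) L) :=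
  inferInstanceAs (FiniteDimensional ℝ Model)

theorem finrank_tangentSpace (L : OrientedPlane) :
    finrank ℝ (TangentSpace 𝓘(ℝ, Model) L) = 12 := by
  refine (imagesEquiv.finrank_eq (R := ℝ) (M := Model)).trans ?_
  simp

theorem tangentToHom_bijective (L : OrientedPlane) : Function.Bijective (tangentToHom L) := by
  refine ⟨tangentToHom_injective L, ?_⟩
  refine (LinearMap.injective_iff_surjective_of_finrank_eq_finrank ?_).1 (tangentToHom_injective L)
  rw [finrank_tangentSpace, finrank_linearMap, finrank_V, L.finrank_eq]

theorem tangentToTensor_bijective (L : OrientedPlane) : Function.Bijective (tangentToTensor L) :=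
  (dualTensorHomEquiv ℝ L.E L.V).symm.bijective.comp (tangentToHom_bijective L)

end OrientedPlane

/-! ### The cross product contraction of tangent vectors -/

theorem sum_bilin_starProjection_eq_sum {ι κ X Y : Type*} [Fintype ι] [Fintype κ]
    [NormedAddCommGroup X] [InnerProductSpace ℝ X] [AddCommGroup Y] [Module ℝ Y]
    (b : OrthonormalBasis κ ℝ X) {S : Submodule ℝ X} [S.HasOrthogonalProjection]
    (e : OrthonormalBasis ι ℝ S) (β : X →ₗ[ℝ] X →ₗ[ℝ] Y) :
    ∑ k, β (b k) (S.starProjection (b k)) = ∑ i, β (e i) (e i) := by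
  have hproj : ∀ y, S.starProjection y = ∑ i, inner ℝ (e i : X) y • (e i : X) := fun y => by
    simp [e.starProjection_eq_sum_rankOne]
  simp only [hproj, map_sum, map_smul]
  rw [Finset.sum_comm]
  refine Finset.sum_congr rfl fun i _ => ?_
  calc ∑ k, inner ℝ (e i : X) (b k) • β (b k) (e i)
      = β (∑ k, inner ℝ (b k) (e i : X) • b k) (e i) := by
        simp only [map_sum, map_smul, LinearMap.sum_apply, LinearMap.smul_apply,
          real_inner_comm (b _)]
    _ = β (e i) (e i) := by rw [b.sum_repr']

namespace OrientedPlane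

/-- The contraction `∑ eⱼ × ξ(eⱼ)` of a tangent vector with the cross product. The sum runs over the
standard basis of `ℝ⁷` instead of a basis of `L`, which makes its smooth dependence on `L` visible;
see `crossTrace_eq_sum`. -/
def crossTrace (L : OrientedPlane) : TangentSpace 𝓘(ℝ, Model) L →ₗ[ℝ] R7 where
  toFun ξ := ∑ k, cross (EuclideanSpace.single k 1) (dproj L ξ (proj L (EuclideanSpace.single k 1)))
  map_add' ξ η := by simp [cross_add_right, Finset.sum_add_distrib]
  map_smul' c ξ := by simp [cross_smul_right, Finset.smul_sum]

theorem crossTrace_apply (L : OrientedPlane) (ξ : TangentSpace 𝓘(ℝ, Model) L) :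
    crossTrace L ξ = ∑ k, cross (EuclideanSpace.single k 1)
      (dproj L ξ (proj L (EuclideanSpace.single k 1))) := by
  simp only [crossTrace, LinearMap.coe_mk, AddHom.coe_mk]

theorem crossTrace_eq_sum {L : OrientedPlane} (e : OrthonormalBasis (Fin 3) ℝ L.E)
    (ξ : TangentSpace 𝓘(ℝ, Model) L) : crossTrace L ξ = ∑ j, cross (e j) (dproj L ξ (e j)) := by
  have htrace := sum_bilin_starProjection_eq_sum (EuclideanSpace.basisFun (Fin 7) ℝ) e
    (crossLin.compl₂ (dproj L ξ).toLinearMap)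
  simp only [EuclideanSpace.basisFun_apply, LinearMap.compl₂_apply, crossLin_apply,
    ContinuousLinearMap.coe_coe] at htrace
  rw [crossTrace_apply, ← htrace]
  rfl

theorem contMDiff_crossTrace : ContMDiff 𝓘(ℝ, Model).tangent 𝓘(ℝ, R7) ∞
    fun p : TangentBundle 𝓘(ℝ, Model) OrientedPlane => crossTrace p.proj p.snd := by
  have hproj : ContMDiff 𝓘(ℝ, Model).tangent 𝓘(ℝ, R7 →L[ℝ] R7) ∞
      fun p : TangentBundle 𝓘(ℝ, Model) OrientedPlane => proj p.proj :=
    (contMDiff_proj (n := ∞)).comp (Bundle.contMDiff_proj (TangentSpace 𝓘(ℝ, Model)))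
  have hdproj : ContMDiff 𝓘(ℝ, Model).tangent 𝓘(ℝ, R7 →L[ℝ] R7) ∞
      fun p : TangentBundle 𝓘(ℝ, Model) OrientedPlane => dproj p.proj p.snd :=
    (contMDiff_snd_tangentBundle_modelSpace (R7 →L[ℝ] R7) 𝓘(ℝ, R7 →L[ℝ] R7)).comp
      (ContMDiff.contMDiff_tangentMap (contMDiff_proj (n := ∞)) le_rfl)
  have hsum : ContDiff ℝ ∞ fun q : (R7 →L[ℝ] R7) × (R7 →L[ℝ] R7) =>
      ∑ k, cross (EuclideanSpace.single k 1) (q.2 (q.1 (EuclideanSpace.single k 1))) :=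
    ContDiff.sum fun k _ => contDiff_cross contDiff_const
      (contDiff_snd.clm_apply (contDiff_fst.clm_apply contDiff_const))
  refine (hsum.contMDiff.comp (hproj.prodMk_space hdproj)).congr fun p => ?_
  rw [crossTrace_apply]
  rfl

theorem IsAssociative.cross_mem_orthogonal {L : OrientedPlane} (h : L.IsAssociative) {u v : R7}
    (hu : u ∈ L.plane) (hv : v ∈ L.V) : cross u v ∈ L.V := by
  intro w hw
  rw [real_inner_comm, inner_cross_swap, real_inner_comm, hv _ (h.cross_mem hu hw), neg_zero]

theorem IsAssociative.crossTrace_mem {L : OrientedPlane} (h : L.IsAssociative)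
    (ξ : TangentSpace 𝓘(ℝ, Model) L) : crossTrace L ξ ∈ L.V := by
  rw [crossTrace_eq_sum L.frame]
  exact L.V.sum_mem fun j _ => h.cross_mem_orthogonal (L.frame j).2 (dproj_mem ξ (L.frame j).2)

/-- The contraction with the cross product at an associative plane, which takes values in `V`. -/
def crossTraceV (L : AssociativeGrassmannian) : TangentSpace 𝓘(ℝ, Model) L.1 →ₗ[ℝ] L.1.V :=
  (crossTrace L.1).codRestrict L.1.V L.2.crossTrace_mem

theorem crossTraceV_eq_zero_iff {L : AssociativeGrassmannian}
    (e : OrthonormalBasis (Fin 3) ℝ L.1.E) (ξ : TangentSpace 𝓘(ℝ, Model) L.1) :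
    crossTraceV L ξ = 0 ↔ ∑ j, cross (e j) (dproj L.1 ξ (e j)) = 0 := by
  rw [← crossTrace_eq_sum, Subtype.ext_iff]
  rfl

theorem exists_dproj_eq {L : OrientedPlane} (e : OrthonormalBasis (Fin 3) ℝ L.E)
    (v : Fin 3 → L.V) : ∃ ξ : TangentSpace 𝓘(ℝ, Model) L, ∀ j, dproj L ξ (e j) = v j := by
  obtain ⟨ξ, hξ⟩ := (tangentToHom_bijective L).2 (e.toBasis.constr ℝ v)
  refine ⟨ξ, fun j => ?_⟩
  rw [← coe_tangentToHom, hξ, ← e.coe_toBasis, Basis.constr_basis]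

theorem crossTraceV_surjective (L : AssociativeGrassmannian) :
    Function.Surjective (crossTraceV L) := by
  intro v
  let e := L.1.frame
  have hmem : cross (e 0) v ∈ L.1.V := L.2.cross_mem_orthogonal (e 0).2 v.2
  obtain ⟨ξ, hξ⟩ := exists_dproj_eq e ![-⟨_, hmem⟩, 0, 0]
  refine ⟨ξ, Subtype.ext ?_⟩
  calc crossTrace L.1 ξ = -cross (e 0) (cross (e 0) v) := by
        simp [crossTrace_eq_sum e, Fin.sum_univ_three, hξ, cross_neg_right, cross_zero_right]
    _ = v := by
        rw [cross_cross_self, v.2 _ (e 0).2, real_inner_self_eq_norm_sq,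
          L.1.orthonormal_coe_frame.1]
        simp

/-! ### The tangent space of the associative Grassmannian -/

theorem sum_cross_eq_zero_of_orthonormal {e v : Fin 3 → R7} (he : Orthonormal ℝ e)
    (h : cross (e 0) (e 1) = e 2) (hv : ∀ i j, inner ℝ (e i) (v j) = 0)
    (hv2 : v 2 = cross (v 0) (e 1) + cross (e 0) (v 1)) : ∑ j, cross (e j) (v j) = 0 := by
  have h0 : cross (e 2) (cross (v 0) (e 1)) = -cross (e 0) (v 0) := calc
    _ = -cross (e 2) (cross (e 1) (v 0)) := by rw [cross_swap (v 0), cross_neg_right]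
    _ = cross (cross (e 2) (e 1)) (v 0) :=
      (cross_cross_assoc_of_orthogonal (he.2 (by decide)) (hv 2 0) (hv 1 0)).symm
    _ = -cross (e 0) (v 0) := by
      rw [cross_swap (e 2), cross_one_two_of_orthonormal he h, cross_neg_left]
  have h1 : cross (e 2) (cross (e 0) (v 1)) = -cross (e 1) (v 1) := calc
    _ = -cross (cross (e 2) (e 0)) (v 1) := by
      rw [cross_cross_assoc_of_orthogonal (he.2 (by decide)) (hv 2 1) (hv 0 1), neg_neg]
    _ = -cross (e 1) (v 1) := by
      rw [cross_swap (e 2), cross_zero_two_of_orthonormal he h, neg_neg]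
  rw [Fin.sum_univ_three, hv2, cross_add_right, h0, h1]
  abel

theorem exists_hasFDerivAt_cross_apply (Q : R7 →L[ℝ] R7) (u v : R7) :
    ∃ T : (R7 →L[ℝ] R7) →L[ℝ] R7, HasFDerivAt (fun Q : R7 →L[ℝ] R7 => cross (Q u) (Q v)) T Q ∧
      ∀ D, T D = cross (Q u) (D v) + cross (D u) (Q v) :=
  ⟨_, crossCLM.hasFDerivAt_of_bilinear (ContinuousLinearMap.apply ℝ R7 u).hasFDerivAt
    (ContinuousLinearMap.apply ℝ R7 v).hasFDerivAt, fun D => by simp [crossCLM_apply]⟩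

section Submanifold

variable [ChartedSpace (EuclideanSpace ℝ (Fin 8)) AssociativeGrassmannian]

theorem dproj_cross_of_mem_assocTangent {L : AssociativeGrassmannian}
    (hι : MDifferentiableAt (𝓡 8) 𝓘(ℝ, Model)
      (Subtype.val : AssociativeGrassmannian → OrientedPlane) L)
    {ξ : TangentSpace 𝓘(ℝ, Model) L.1} (hξ : ξ ∈ assocTangent L) {u v : R7} (hu : u ∈ L.1.plane)
    (hv : v ∈ L.1.plane) :
    dproj L.1 ξ (cross u v) = cross (dproj L.1 ξ u) v + cross u (dproj L.1 ξ v) := by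
  obtain ⟨η, hη⟩ := hξ
  obtain ⟨T, hTderiv, hT⟩ := exists_hasFDerivAt_cross_apply (proj L.1) u v
  have hP : HasMFDerivAt (𝓡 8) 𝓘(ℝ, R7 →L[ℝ] R7) (fun M : AssociativeGrassmannian => proj M.1) L
      ((dproj L.1).comp (mfderiv (𝓡 8) 𝓘(ℝ, Model)
        (Subtype.val : AssociativeGrassmannian → OrientedPlane) L)) :=
    HasMFDerivAt.comp L (hasMFDerivAt_proj L.1) hι.hasMFDerivAt
  have hcross := HasMFDerivAt.comp L hTderiv.hasMFDerivAt hP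
  have hderiv : dproj L.1 ξ (cross (proj L.1 u) (proj L.1 v)) =
      T (dproj L.1 ξ) - proj L.1 (T (dproj L.1 ξ)) := by
    rw [← hη]
    exact apply_eq_sub_of_hasMFDerivAt_of_apply_eq_self hP hcross (fun M => proj_of_mem
      (M.2.cross_mem (Submodule.starProjection_apply_mem _ _)
        (Submodule.starProjection_apply_mem _ _))) η
  rw [proj_of_mem hu, proj_of_mem hv, hT, proj_of_mem hu, proj_of_mem hv] at hderiv
  have hnormal : cross u (dproj L.1 ξ v) + cross (dproj L.1 ξ u) v ∈ L.1.V := by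
    rw [cross_swap _ v]
    exact L.1.V.add_mem (L.2.cross_mem_orthogonal hu (dproj_mem ξ hv))
      (L.1.V.neg_mem (L.2.cross_mem_orthogonal hv (dproj_mem ξ hu)))
  rw [hderiv, proj_of_mem_orthogonal hnormal, sub_zero, add_comm]

theorem assocTangent_le_ker {L : AssociativeGrassmannian}
    (hι : MDifferentiableAt (𝓡 8) 𝓘(ℝ, Model)
      (Subtype.val : AssociativeGrassmannian → OrientedPlane) L) :
    assocTangent L ≤ LinearMap.ker (crossTraceV L) := by
  intro ξ hξ
  have hmem : ∀ i, (L.1.frame i : R7) ∈ L.1.plane := fun i => (L.1.frame i).2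
  have hderiv := dproj_cross_of_mem_assocTangent hι hξ (hmem 0) (hmem 1)
  rw [L.2.cross_frame] at hderiv
  exact (crossTraceV_eq_zero_iff L.1.frame ξ).2 <|
    sum_cross_eq_zero_of_orthonormal (v := fun j => dproj L.1 ξ (L.1.frame j))
      L.1.orthonormal_coe_frame L.2.cross_frame
      (fun i j => dproj_mem ξ (hmem j) _ (hmem i)) hderiv

theorem assocTangent_eq_ker {L : AssociativeGrassmannian}
    (hι : MDifferentiableAt (𝓡 8) 𝓘(ℝ, Model)
      (Subtype.val : AssociativeGrassmannian → OrientedPlane) L)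
    (hinj : Function.Injective (mfderiv (𝓡 8) 𝓘(ℝ, Model)
      (Subtype.val : AssociativeGrassmannian → OrientedPlane) L)) :
    assocTangent L = LinearMap.ker (crossTraceV L) := by
  refine Submodule.eq_of_le_of_finrank_eq (assocTangent_le_ker hι) ?_
  have hker := (crossTraceV L).finrank_range_add_finrank_ker
  rw [LinearMap.range_eq_top.2 (crossTraceV_surjective L), finrank_top, finrank_V,
    finrank_tangentSpace] at hker
  have htangent : finrank ℝ (assocTangent L) = 8 :=
    (LinearMap.finrank_range_of_inj hinj).trans finrank_euclideanSpace_fin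
  omega

/-- The isomorphism of the normal bundle with the complementary bundle. -/
def normalIso (h : ∀ L, assocTangent L = LinearMap.ker (crossTraceV L)) : NormalBundleIso where
  toEquiv L := (Submodule.quotEquivOfEq _ _ (h L)).trans
    ((crossTraceV L).quotKerEquivOfSurjective (crossTraceV_surjective L))
  contMDiffOn := by
    refine contMDiff_crossTrace.contMDiffOn.congr fun p (hp : p.proj.IsAssociative) => ?_
    rw [normalMapLift, dif_pos hp]
    rfl

theorem coe_normalIso_mk (h : ∀ L, assocTangent L = LinearMap.ker (crossTraceV L))
    (L : AssociativeGrassmannian) (ξ : TangentSpace 𝓘(ℝ, Model) L.1) :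
    ((normalIso h).toEquiv L (Submodule.Quotient.mk ξ) : R7) = crossTrace L.1 ξ := rfl

end Submanifold

end OrientedPlane

/-! ### Tangent vectors as tensors -/

theorem dualTensorHomEquiv_symm_eq_sum_coord_tmul_iff {ι R M N : Type*} [Fintype ι] [CommRing R]
    [AddCommGroup M] [AddCommGroup N] [Module R M] [Module R N] [Module.Free R M]
    [Module.Finite R M] (b : Basis ι R M) (f : M →ₗ[R] N) (v : ι → N) :
    (dualTensorHomEquiv R M N).symm f = ∑ i, b.coord i ⊗ₜ[R] v i ↔ ∀ i, f (b i) = v i := by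
  classical
  have hsum : ∀ j, dualTensorHomEquiv R M N (∑ i, b.coord i ⊗ₜ[R] v i) (b j) = v j := fun j => by
    simp [dualTensorHomEquiv, LinearMap.sum_apply, Finsupp.single_apply, ite_smul]
  rw [LinearEquiv.symm_apply_eq]
  exact ⟨fun h j => by rw [h, hsum], fun h => b.ext fun j => by rw [h, hsum]⟩

namespace OrientedPlane

theorem tangentToTensor_eq_iff {L : OrientedPlane} (e : OrthonormalBasis (Fin 3) ℝ L.E)
    (ξ : TangentSpace 𝓘(ℝ, Model) L) (v : Fin 3 → L.V) :
    tangentToTensor L ξ = ∑ j, e.toBasis.coord j ⊗ₜ[ℝ] v j ↔ ∀ j, dproj L ξ (e j) = v j := by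
  refine (dualTensorHomEquiv_symm_eq_sum_coord_tmul_iff e.toBasis (tangentToHom L ξ) v).trans ?_
  simp only [Subtype.ext_iff, e.coe_toBasis, coe_tangentToHom]

theorem crossTrace_eq_sum_of_tangentToTensor_eq {L : OrientedPlane}
    (e : OrthonormalBasis (Fin 3) ℝ L.E) {ξ : TangentSpace 𝓘(ℝ, Model) L} {v : Fin 3 → L.V}
    (h : tangentToTensor L ξ = ∑ j, e.toBasis.coord j ⊗ₜ[ℝ] v j) :
    crossTrace L ξ = ∑ j, cross (e j) (v j) := by
  simp only [crossTrace_eq_sum e, (tangentToTensor_eq_iff e ξ v).1 h]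

theorem image_tangentToTensor_ker_crossTrace {L : OrientedPlane}
    (e : OrthonormalBasis (Fin 3) ℝ L.E) :
    tangentToTensor L '' (LinearMap.ker (crossTrace L) : Set (TangentSpace 𝓘(ℝ, Model) L)) =
      {x | ∃ v : Fin 3 → L.V,
        x = ∑ j, e.toBasis.coord j ⊗ₜ[ℝ] v j ∧ ∑ j, cross (e j) (v j) = 0} := by
  ext x
  constructor
  · rintro ⟨ξ, hξ, rfl⟩
    have hx : tangentToTensor L ξ = ∑ j, e.toBasis.coord j ⊗ₜ[ℝ] ⟨_, dproj_mem ξ (e j).2⟩ :=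
      (tangentToTensor_eq_iff e ξ _).2 fun _ => rfl
    exact ⟨_, hx, (crossTrace_eq_sum_of_tangentToTensor_eq e hx).symm.trans hξ⟩
  · rintro ⟨v, rfl, hv⟩
    obtain ⟨ξ, hξ⟩ := (tangentToTensor_bijective L).2 (∑ j, e.toBasis.coord j ⊗ₜ[ℝ] v j)
    exact ⟨ξ, (crossTrace_eq_sum_of_tangentToTensor_eq e hξ).trans hv, hξ⟩

end OrientedPlane

end

theorem lemma5_general :
    (∀ L : OrientedPlane, Function.Bijective L.tangentToTensor) ∧
    ∃ _ : ChartedSpace (EuclideanSpace ℝ (Fin 8)) AssociativeGrassmannian,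
      IsManifold (𝓡 8) ∞ AssociativeGrassmannian ∧
      Manifold.IsSmoothEmbedding (𝓡 8) 𝓘(ℝ, OrientedPlane.Model) ∞
        (Subtype.val : AssociativeGrassmannian → OrientedPlane) ∧
      (∀ (L : AssociativeGrassmannian) (e : OrthonormalBasis (Fin 3) ℝ L.1.E),
        L.1.tangentToTensor '' (assocTangent L : Set _) =
          {x | ∃ v : Fin 3 → L.1.V,
            x = ∑ j, e.toBasis.coord j ⊗ₜ[ℝ] v j ∧ ∑ j, cross (e j) (v j) = 0}) ∧
      ∃ Φ : NormalBundleIso,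
        ∀ (L : AssociativeGrassmannian) (e : OrthonormalBasis (Fin 3) ℝ L.1.E)
          (ξ : TangentSpace 𝓘(ℝ, OrientedPlane.Model) L.1) (v : Fin 3 → L.1.V),
          L.1.tangentToTensor ξ = ∑ j, e.toBasis.coord j ⊗ₜ[ℝ] v j →
            (Φ.toEquiv L (Submodule.Quotient.mk ξ) : R7) = ∑ j, cross (e j) (v j) := by
  let charted : ChartedSpace (EuclideanSpace ℝ (Fin 8)) AssociativeGrassmannian :=
    OrientedPlane.assocSliceAtlas.chartedSpace
  have hman : IsManifold (𝓡 8) ∞ AssociativeGrassmannian :=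
    OrientedPlane.assocSliceAtlas.isManifold
  have himm : Manifold.IsImmersionOfComplement (Fin 4 → ℝ) (𝓡 8) 𝓘(ℝ, OrientedPlane.Model) ∞
      (Subtype.val : AssociativeGrassmannian → OrientedPlane) :=
    OrientedPlane.assocSliceAtlas.isImmersionOfComplement
  have hker : ∀ L, assocTangent L = LinearMap.ker (OrientedPlane.crossTraceV L) := fun L =>
    OrientedPlane.assocTangent_eq_ker (himm.contMDiff.mdifferentiable (by simp) L)
      (mfderiv_injective_of_isImmersionAtOfComplement (himm L) (by simp))
  refine ⟨OrientedPlane.tangentToTensor_bijective, charted, hman,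
    ⟨himm.isImmersion, Topology.IsEmbedding.subtypeVal⟩, fun L e => ?_,
    OrientedPlane.normalIso hker, fun L e ξ v hv => ?_⟩
  · rw [hker, OrientedPlane.crossTraceV, LinearMap.ker_codRestrict,
      OrientedPlane.image_tangentToTensor_ker_crossTrace e]
  · rw [OrientedPlane.coe_normalIso_mk, OrientedPlane.crossTrace_eq_sum_of_tangentToTensor_eq e hv]

theorem lemma5 :
    -- the canonical map `T_L G(3,7) → E_L* ⊗ V_L` is an isomorphism
    (∀ L : OrientedPlane, Function.Bijective L.tangentToTensor) ∧
    -- the associative Grassmannian is a smooth embedded submanifold of `G(3,7)`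
    ∃ _ : ChartedSpace (EuclideanSpace ℝ (Fin 8)) AssociativeGrassmannian,
      IsManifold (𝓡 8) ∞ AssociativeGrassmannian ∧
      Manifold.IsSmoothEmbedding (𝓡 8) 𝓘(ℝ, OrientedPlane.Model) ∞
        (Subtype.val : AssociativeGrassmannian → OrientedPlane) ∧
      -- its tangent space at `L = ⟨e₁, e₂, e₁ × e₂⟩`
      (∀ (L : AssociativeGrassmannian) (e : OrthonormalBasis (Fin 3) ℝ L.1.E),
        (e 2 : R7) = cross (e 0) (e 1) →
          L.1.tangentToTensor '' (assocTangent L : Set _) =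
            {x | ∃ v : Fin 3 → L.1.V,
              x = ∑ j, e.toBasis.coord j ⊗ₜ[ℝ] v j ∧ ∑ j, cross (e j) (v j) = 0}) ∧
      -- its normal bundle is isomorphic to `V`, through the cross product
      ∃ Φ : NormalBundleIso,
        ∀ (L : AssociativeGrassmannian) (e : OrthonormalBasis (Fin 3) ℝ L.1.E),
          (e 2 : R7) = cross (e 0) (e 1) →
            ∀ (ξ : TangentSpace 𝓘(ℝ, OrientedPlane.Model) L.1) (v : Fin 3 → L.1.V),
              L.1.tangentToTensor ξ = ∑ j, e.toBasis.coord j ⊗ₜ[ℝ] v j →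
                (Φ.toEquiv L (Submodule.Quotient.mk ξ) : R7) = ∑ j, cross (e j) (v j) := by
  obtain ⟨hbij, charted, hman, hemb, htan, Φ, hΦ⟩ := lemma5_general
  exact ⟨hbij, charted, hman, hemb, fun L e _ => htan L e, Φ, fun L e _ => hΦ L e⟩
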